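/- Fix $a\in\mathbb C$. For $\delta>0$ let $\mathcal V_\delta:=a+\delta+(1+i)\mathbb Z[i]\,\delta$ (a rotated square lattice of mesh $\sqrt2\,\delta$ having $a$ as the midpoint of a face), let $\mathcal V^m_\delta$ be the set of midpoints of its edges (medial vertices), and let $\mathcal V^1_\delta:=\mathcal V_\delta+\frac\delta2$, $\mathcal V^i_\delta:=\mathcal V_\delta-\frac\delta2$, $\mathcal V^\lambda_\delta:=\mathcal V_\delta+\frac{i\delta}2$, $\mathcal V^{\bar\lambda}_\delta:=\mathcal V_\delta-\frac{i\delta}2$ with $\lambda:=e^{-i\pi/4}$ (corners). A corner and a medial vertex are adjacent if they are at distance $\delta/2$. Let $[\mathbb C,a]$ be the double cover of $\mathbb C\setminus\{a\}$ ramified at $a$, on which $\sqrt{z-a}$ is naturally defined, let $\mathbb X^\pm$ be its sheets $\{\pm\operatorname{Re}\sqrt{z-a}>0\}$ over $\mathbb C\setminus(a+\mathbb R_-)$ and $\mathbb Y^\pm$ its sheets $\{\pm\operatorname{Im}\sqrt{z-a}>0\}$ over $\mathbb C\setminus(a+\mathbb R_+)$, and let $[\mathbb C_\delta,a]$ be the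 lift of the corners and medial vertices, with adjacency lifted along segments. A function $K$ on $[\mathbb C_\delta,a]$ is a *spinor* if its values at the two lifts of each point are opposite; it is *s-holomorphic* if $K(x)=\frac12\big(K(z)+\tau^2\overline{K(z)}\big)$ for every lifted corner $x$ of type $\tau\in\{1,i,\lambda,\bar\lambda\}$ and every adjacent lifted medial vertex $z$. For simple random walk with steps $(\pm1\pm i)\delta$, let $\mathrm{hm}^{\mathbb X}_\delta(z)$, $z\in\mathcal V^1_\delta$, be the probability that the walk started at $z$ visits $a+\frac{3\delta}2$, and does so before visiting $a+\mathbb R_-$; and let $\mathrm{hm}^{\mathbb Y}_\delta(z)$, $z\in\mathcal V^i_\delta$, be the probability that it visits $a+\frac\delta2$, and does so before visiting any other point of $a+\mathbb R_+$. Put $H_{[\mathbb C_\delta,a]}:=\pm\mathrm{hm}^{\mathbb X}_\delta$ at the lifts of $\mathcal V^1_\delta$ to $\mathbb X^\pm$, $H_{[\mathbb C_\delta,a]}:=\mp i\,\mathrm{hm}^{\mathbb Y}_\delta$ at the lifts of $\mathcal V^i_\delta$ to $\mathbb Y^\pm$, and $H_{[\mathbb C_\delta,a]}:=0$ at the other lifts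 of $\mathcal V^1_\delta\cup\mathcal V^i_\delta$ except those of $a+\frac\delta2$. Let $\vartheta(\delta):=H_{[\mathbb C_\delta,a]}\big(a+\frac{3\delta}2+2\delta\lfloor\frac1{2\delta}\rfloor\big)$, the argument being taken on $\mathbb X^+$. **Theorem.** There are families $G_{[\mathbb C_\delta,a]}$, $\tilde G_{[\mathbb C_\delta,a]}$, $\delta>0$, of everywhere s-holomorphic spinors on $[\mathbb C_\delta,a]$ such that: 1. $G_{[\mathbb C_\delta,a]}(z)=\delta\sum_{j\ge0}H_{[\mathbb C_\delta,a]}(z-2j\delta)$ at the lifts of $\mathcal V^1_\delta$ to $\mathbb X^\pm$, $G_{[\mathbb C_\delta,a]}(z)=-\delta\sum_{j\ge1}H_{[\mathbb C_\delta,a]}(z+2j\delta)$ at the lifts of $\mathcal V^i_\delta$ to $\mathbb Y^\pm$, and $G_{[\mathbb C_\delta,a]}=0$ at the other lifts of $\mathcal V^1_\delta\cup\mathcal V^i_\delta$. 2. $\tilde G_{[\mathbb C_\delta,a]}(z)=-i\delta\sum_{j\ge0}H_{[\mathbb C_\delta,a]}(z+\delta+2j\delta)$ at the lifts of $\mathcal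 V^1_\delta$ to $\mathbb Y^\pm$, $\tilde G_{[\mathbb C_\delta,a]}(z)=i\delta\sum_{j\ge0}H_{[\mathbb C_\delta,a]}(z-\delta-2j\delta)$ at the lifts of $\mathcal V^i_\delta$ to $\mathbb X^\pm$, and $\tilde G_{[\mathbb C_\delta,a]}=0$ at the other lifts of $\mathcal V^1_\delta\cup\mathcal V^i_\delta$. 3. As $\delta\to0$, $\vartheta(\delta)^{-1}G_{[\mathbb C_\delta,a]}\to\sqrt{z-a}$ and $\vartheta(\delta)^{-1}\tilde G_{[\mathbb C_\delta,a]}\to i\sqrt{z-a}$ on compact subsets of $[\mathbb C,a]$, i.e. uniformly over the lifted medial vertices in any compact subset of $[\mathbb C,a]$. All the sums converge absolutely. In 1 and 2 the translates of $z$ stay on the sheet ($\mathbb X^\pm$ or $\mathbb Y^\pm$) of $z$; where they reach the slit $H_{[\mathbb C_\delta,a]}$ is $0$, except that in sums over $\mathbb Y^\pm$ one uses $H_{[\mathbb C_\delta,a]}(a+\frac\delta2)=\mp i$. -/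

import Mathlib

open Complex

noncomputable section

/-! ### The rotated square lattice of mesh size `√2 δ` having `a` as the midpoint of a face -/

/-- Vertices: the lattice `(1+i)ℤ²δ`, translated so that `a` is the midpoint of a face. -/
def vertexSet (δ : ℝ) (a : ℂ) : Set ℂ :=
  {v | ∃ m n : ℤ, v = a + δ + δ * ((1 + I) * (m + n * I))}

/-- Medial vertices: the midpoints of the edges, an edge joining two vertices at distance `√2 δ`. -/
def medialSet (δ : ℝ) (a : ℂ) : Set ℂ :=
  {z | ∃ u ∈ vertexSet δ a, ∃ v ∈ vertexSet δ a, dist u v = √2 * δ ∧ z = (u + v) / 2}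

/-- The four types of corners. -/
inductive CornerType where
  | one
  | i
  | lam
  | lamBar

/-- The direction from a vertex to its corner of the given type. -/
def CornerType.dir : CornerType → ℂ
  | .one => 1
  | .i => -1
  | .lam => I
  | .lamBar => -I

/-- The complex number `τ` spanning the line `τℝ` attached to a type of corners: `1`, `i`, `λ`
or the conjugate of `λ`, where `λ = exp(-iπ/4)`. -/
def CornerType.val : CornerType → ℂ
  | .one => 1
  | .i => I
  | .lam => exp (-(Real.pi / 4) * I)
  | .lamBar => exp ((Real.pi / 4) * I)

/-- The corners of type `τ`: the points `v + δ/2`, `v - δ/2`, `v + iδ/2`, `v - iδ/2` (for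
`τ = 1, i, λ, conj λ` respectively) where `v` is a vertex. -/
def cornerSet (δ : ℝ) (a : ℂ) (τ : CornerType) : Set ℂ :=
  {x | ∃ v ∈ vertexSet δ a, x = v + δ / 2 * τ.dir}

/-- The set of all corners and all medial vertices. -/
def cornerMedialSet (δ : ℝ) (a : ℂ) : Set ℂ :=
  medialSet δ a ∪ ⋃ τ : CornerType, cornerSet δ a τ

/-! ### The double cover -/

/-- The double cover of `ℂ ∖ {a}` ramified at `a`: pairs `(z, r)` where `z ≠ a` and `r` is a
square root of `z - a`, with the topology induced from `ℂ × ℂ`. -/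
abbrev DoubleCover (a : ℂ) : Type := {p : ℂ × ℂ // p.1 ≠ a ∧ p.2 ^ 2 = p.1 - a}

namespace DoubleCover

variable {a : ℂ}

/-- The covering map. -/
def pt (p : DoubleCover a) : ℂ := p.1.1

/-- The function `√(z - a)` on the double cover. -/
def root (p : DoubleCover a) : ℂ := p.1.2

/-- The other point of the double cover over the same point of the plane. -/
def flip (p : DoubleCover a) : DoubleCover a :=
  ⟨(p.1.1, -p.1.2), p.2.1, by rw [neg_sq]; exact p.2.2⟩

/-- Adjacency of a lifted corner `p` and a lifted medial vertex `q`: their projections are at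
distance `δ/2`, and `q` is the endpoint of the lift, starting at `p`, of the segment between these
projections. (Along this segment `(z - a) / (p.pt - a)` stays off the closed negative half-axis, so
the continuous square root of it that equals `1` at `p` has positive real part.) -/
def Adjacent (δ : ℝ) (p q : DoubleCover a) : Prop :=
  dist p.pt q.pt = δ / 2 ∧ 0 < (q.root / p.root).re

end DoubleCover

/-- `K` changes sign between the two lifts of each corner and of each medial vertex. -/
def IsSpinor (δ : ℝ) (a : ℂ) (K : DoubleCover a → ℂ) : Prop :=
  ∀ p : DoubleCover a, p.pt ∈ cornerMedialSet δ a → K p.flip = -K p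

/-- `K` is s-holomorphic at every lifted corner: its value there is the projection to `τℝ` of its
value at each adjacent lifted medial vertex. (Only the values of `K` at lifted corners and lifted
medial vertices matter.) -/
def IsSHolomorphic (δ : ℝ) (a : ℂ) (K : DoubleCover a → ℂ) : Prop :=
  ∀ (τ : CornerType) (p q : DoubleCover a),
    p.pt ∈ cornerSet δ a τ → q.pt ∈ medialSet δ a → p.Adjacent δ q →
      K p = 1 / 2 * (K q + τ.val ^ 2 * (starRingEnd ℂ) (K q))

/-- Convergence on compact subsets of the double cover, as `δ → 0`, of a family of functions on the
lifted medial vertices. -/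
def ConvergesOnCompacts (a : ℂ) (F : ℝ → DoubleCover a → ℂ) (f : DoubleCover a → ℂ) : Prop :=
  ∀ K : Set (DoubleCover a), IsCompact K → ∀ ε > (0 : ℝ), ∃ δ₀ > (0 : ℝ), ∀ δ : ℝ,
    0 < δ → δ < δ₀ → ∀ p ∈ K, p.pt ∈ medialSet δ a → ‖F δ p - f p‖ < ε

/-! ### Harmonic measure -/

/-- The probability that simple random walk started at `z`, with the four equally likely steps
`(±1 ± i)δ`, visits the point `b` within its first `n` steps and does not visit `S ∖ {b}` before
its first visit to `b` (by conditioning on the first step). -/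
def hitProb (δ : ℝ) (b : ℂ) (S : Set ℂ) : ℕ → ℂ → ℝ
  | 0, z => open Classical in if z = b then 1 else 0
  | n + 1, z => open Classical in
      if z = b then 1
      else if z ∈ S then 0
      else (hitProb δ b S n (z + δ * (1 + I)) + hitProb δ b S n (z + δ * (1 - I))
        + hitProb δ b S n (z - δ * (1 + I)) + hitProb δ b S n (z - δ * (1 - I))) / 4

/-- Discrete harmonic measure of `{b}` as seen from `z`: the probability that simple random walk
started at `z` visits `b`, and visits it before any other point of the boundary `S ∪ {b}`. It is the
increasing limit of the probabilities that this happens within `n` steps. -/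
def harmonicMeasure (δ : ℝ) (b : ℂ) (S : Set ℂ) (z : ℂ) : ℝ :=
  ⨆ n : ℕ, hitProb δ b S n z

/-- The closed half-line `a + ℝ₊`. -/
def rightSlit (a : ℂ) : Set ℂ := {z | ∃ t : ℝ, 0 ≤ t ∧ z = a + t}

/-- The closed half-line `a + ℝ₋`. -/
def leftSlit (a : ℂ) : Set ℂ := {z | ∃ t : ℝ, 0 ≤ t ∧ z = a - t}

/-! ### The spinor `H` on the corners of types `1` and `i`

`H` equals `±HX` at the lifts to `𝕏^±` of the corners of type `1`, equals `±HY` at the lifts to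
`𝕐^±` of the corners of type `i`, and vanishes at the remaining lifted corners of types `1` and `i`
other than the two lifts of `a + δ/2`, where `H` is not defined. Here `𝕏^±` and `𝕐^±` are the sheets
of the double cover where `± Re √(z - a) > 0` and `± Im √(z - a) > 0`. -/

/-- The branch on `𝕏⁺`: the harmonic measure of the tip `a + 3δ/2`, extended by `0` to the slit. -/
def HX (δ : ℝ) (a z : ℂ) : ℂ :=
  (harmonicMeasure δ (a + 3 * δ / 2) (leftSlit a) z : ℂ)

/-- The branch on `𝕐⁺`: `-i` times the harmonic measure of the tip `a + δ/2`, with its boundary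
values `-i` at `a + δ/2` and `0` elsewhere on the slit. -/
def HY (δ : ℝ) (a z : ℂ) : ℂ :=
  -I * (harmonicMeasure δ (a + δ / 2) (rightSlit a) z : ℂ)

/-- The normalisation `ϑ(δ) = H(a + 3δ/2 + 2δ⌊1/(2δ)⌋)`, the argument being lifted to `𝕏⁺`. -/
def vartheta (δ : ℝ) (a : ℂ) : ℂ :=
  HX δ a (a + 3 * δ / 2 + 2 * δ * (⌊1 / (2 * δ)⌋ : ℤ))

/-! ### The sums of `H` along horizontal half-lines

The factor `Real.sign` selects the sheet: it is `±1` on `𝕏^±` (resp. `𝕐^±`), and it is `0` at the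
points that lie above the slit, where the functions below vanish. -/

/-- On the lifts to `𝕏^±` of the corners of type `1`, `G(z) = δ ∑_{j ≥ 0} H(z - 2jδ)`; on the lifts to
`𝕐^±` of the corners of type `i`, `G(z) = -δ ∑_{j ≥ 1} H(z + 2jδ)`; `G` vanishes at the other lifted
corners of these two types. The sums converge absolutely. -/
def IsSlitSumG (δ : ℝ) (a : ℂ) (G : DoubleCover a → ℂ) : Prop :=
  (∀ p : DoubleCover a, p.pt ∈ cornerSet δ a .one →
    HasSum (fun j : ℕ => (δ : ℂ) * ((Real.sign p.root.re : ℂ) * HX δ a (p.pt - 2 * j * δ))) (G p)) ∧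
  (∀ p : DoubleCover a, p.pt ∈ cornerSet δ a .i →
    HasSum (fun j : ℕ =>
      -(δ : ℂ) * ((Real.sign p.root.im : ℂ) * HY δ a (p.pt + 2 * (j + 1) * δ))) (G p))

/-- On the lifts to `𝕐^±` of the corners of type `1`, `G̃(z) = -iδ ∑_{j ≥ 0} H(z + δ + 2jδ)`; on the
lifts to `𝕏^±` of the corners of type `i`, `G̃(z) = iδ ∑_{j ≥ 0} H(z - δ - 2jδ)`; `G̃` vanishes at the
other lifted corners of these two types. The sums converge absolutely. -/
def IsSlitSumGTilde (δ : ℝ) (a : ℂ) (G : DoubleCover a → ℂ) : Prop :=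
  (∀ p : DoubleCover a, p.pt ∈ cornerSet δ a .one →
    HasSum (fun j : ℕ =>
      -I * (δ : ℂ) * ((Real.sign p.root.im : ℂ) * HY δ a (p.pt + δ + 2 * j * δ))) (G p)) ∧
  (∀ p : DoubleCover a, p.pt ∈ cornerSet δ a .i →
    HasSum (fun j : ℕ =>
      I * (δ : ℂ) * ((Real.sign p.root.re : ℂ) * HX δ a (p.pt - δ - 2 * j * δ))) (G p))

end

/-!
All objects are computed explicitly. In units of `δ` and relative to `a`, the corners of types `1` and
`i` are the points `(m + 1/2) + in` with `m + n` odd and even, respectively, and s-holomorphicity of a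
function with real values `α(m, n)` at the former and imaginary values `iβ(m, n)` at the latter means
that `α` and `β` satisfy the discrete Cauchy–Riemann equations on every square of this lattice: the
value at a medial vertex is the sum of the values at the corners above and below it, and the equations
say that the projections to `λℝ` and `conj λ ℝ` agree on both sides of a square.

On the diagonal lattice the functions `exp(imt) u(t)ⁿ`, `u(t) = cos t / (1 + sin t)`, are discrete
holomorphic, and integrating them against `(sin t)^(-3/2)` gives a discrete square root,
`sqrtIntegral`. The Cauchy–Riemann equations hold pointwise under the integral
(`sqrtIntegral_cauchyRiemann`). On the real axis the horizontal differences satisfy a two-term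
recursion obtained from one integration by parts (`stepIntegral_recursion`); hence the real part
`discreteSqrt` vanishes on the slit `m < 0`, and by symmetry the imaginary part
`discreteSqrt (-1 - m) n` vanishes on the slit `m ≥ 0`. Therefore these functions on the closed upper
half-plane extend by reflection to an s-holomorphic spinor on the double cover
(`isSHolomorphic_spinorExt`); this is `G`, and `G̃` is obtained from the translate of `iG` by `δ`.

The horizontal differences of `discreteSqrt` are harmonic off the slit and the tip. They tend to `0` at
infinity, along rows by the Riemann–Lebesgue lemma and away from the axis by dominated convergence,
so by the maximum principle they are the harmonic measure of the tip (`HX_latticePt`,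
`HY_latticePt`). As `discreteSqrt` tends to `0` along rows towards the slit
(`tendsto_discreteSqrt_left`), the sums of `H` over half-lines telescope to it.

For the scaling limit one substitutes `t = δs` in the integral. Dominated convergence
(`tendsto_sqrt_mul_sqrtIntegral`) and the Gaussian integral (`limitIntegral_eq`) show that
`√δ · discreteSqrt` converges to a constant multiple of `Re √(z - a)`. On the positive axis
`discreteSqrt` is an explicit multiple of its last difference (`sqrtIntegral_of_nonneg`), which shows
that `ϑ(δ) / √δ` tends to the same constant (`tendsto_vartheta`), so that the constant cancels.
-/

noncomputable section

open MeasureTheory Filter Topology Set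

/-! ### The integral representation of the discrete square root -/

/-- The vertical decay factor `u(t) = cos t / (1 + sin t)`: the functions `exp(imt) u(t)ⁿ` are
discrete harmonic for the diagonal walk, since `2 u = (1 + u²) cos t`. -/
def decay (t : ℝ) : ℝ := Real.cos t / (1 + Real.sin t)

lemma sin_pos_of_mem {t : ℝ} (ht : t ∈ Ioc 0 (Real.pi / 2)) : 0 < Real.sin t :=
  Real.sin_pos_of_pos_of_lt_pi ht.1 (by linarith [ht.2, Real.pi_pos])

lemma sin_nonneg_of_mem {t : ℝ} (ht : t ∈ Icc 0 (Real.pi / 2)) : 0 ≤ Real.sin t :=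
  Real.sin_nonneg_of_nonneg_of_le_pi ht.1 (by linarith [ht.2, Real.pi_pos])

lemma decay_mul_one_add_sin {t : ℝ} (ht : t ∈ Icc 0 (Real.pi / 2)) :
    decay t * (1 + Real.sin t) = Real.cos t :=
  div_mul_cancel₀ _ (by linarith [sin_nonneg_of_mem ht])

lemma decay_mul_cos {t : ℝ} (ht : t ∈ Icc 0 (Real.pi / 2)) :
    decay t * Real.cos t = 1 - Real.sin t := by
  have h := sin_nonneg_of_mem ht
  rw [decay, div_mul_eq_mul_div, div_eq_iff (by linarith)]
  nlinarith [Real.sin_sq_add_cos_sq t]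

lemma decay_nonneg {t : ℝ} (ht : t ∈ Icc 0 (Real.pi / 2)) : 0 ≤ decay t :=
  div_nonneg (Real.cos_nonneg_of_mem_Icc ⟨by linarith [ht.1, Real.pi_pos], ht.2⟩)
    (by linarith [sin_nonneg_of_mem ht])

lemma decay_pos {t : ℝ} (ht : t ∈ Ico 0 (Real.pi / 2)) : 0 < decay t :=
  div_pos (Real.cos_pos_of_mem_Ioo ⟨by linarith [ht.1, Real.pi_pos], ht.2⟩)
    (by linarith [sin_nonneg_of_mem (Ico_subset_Icc_self ht)])

lemma decay_le_one {t : ℝ} (ht : t ∈ Icc 0 (Real.pi / 2)) : decay t ≤ 1 := by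
  have h := sin_nonneg_of_mem ht
  rw [decay, div_le_one (by linarith)]
  linarith [Real.cos_le_one t]

lemma decay_lt_one {t : ℝ} (ht : t ∈ Ioc 0 (Real.pi / 2)) : decay t < 1 := by
  have h := sin_pos_of_mem ht
  rw [decay, div_lt_one (by linarith)]
  linarith [Real.cos_le_one t]

lemma one_sub_decay_le {t : ℝ} (ht : t ∈ Icc 0 (Real.pi / 2)) : 1 - decay t ≤ t := by
  have h1 := decay_mul_cos ht
  have h2 := decay_nonneg ht
  nlinarith [Real.cos_le_one t, Real.sin_le ht.1]

lemma one_sub_decay_pow_le {t : ℝ} (ht : t ∈ Icc 0 (Real.pi / 2)) (n : ℕ) :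
    1 - decay t ^ n ≤ n * t := by
  have h := one_add_mul_sub_le_pow (a := decay t) (by linarith [decay_nonneg ht]) n
  nlinarith [one_sub_decay_le ht, Nat.cast_nonneg (α := ℝ) n]

lemma decay_pow_mem {t : ℝ} (ht : t ∈ Icc 0 (Real.pi / 2)) (n : ℕ) :
    decay t ^ n ∈ Icc (0 : ℝ) 1 :=
  ⟨pow_nonneg (decay_nonneg ht) n, pow_le_one₀ (decay_nonneg ht) (decay_le_one ht)⟩

lemma measurable_decay : Measurable decay :=
  Real.measurable_cos.div (measurable_const.add Real.measurable_sin)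

/-- The bracket `sin(xt - π/4) u(t)ⁿ + sin(t/2 + π/4)` of the integrand. The second term makes it
vanish at `t = 0`, which compensates the factor `(sin t)^(-3/2)`; it is chosen such that the whole
bracket vanishes identically for `x = -1/2`, `n = 0`. -/
def bracket (x : ℝ) (n : ℕ) (t : ℝ) : ℝ :=
  Real.sin (x * t - Real.pi / 4) * decay t ^ n + Real.sin (t / 2 + Real.pi / 4)

lemma measurable_bracket (x : ℝ) (n : ℕ) : Measurable (bracket x n) := by
  have := measurable_decay
  unfold bracket
  fun_prop

lemma abs_bracket_le_two {t : ℝ} (ht : t ∈ Icc 0 (Real.pi / 2)) (x : ℝ) (n : ℕ) :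
    |bracket x n t| ≤ 2 := by
  have h := decay_pow_mem ht n
  have h1 := Real.abs_sin_le_one (x * t - Real.pi / 4)
  have h2 := Real.abs_sin_le_one (t / 2 + Real.pi / 4)
  calc |bracket x n t| ≤ |Real.sin (x * t - Real.pi / 4)| * |decay t ^ n|
        + |Real.sin (t / 2 + Real.pi / 4)| := by
        rw [← abs_mul]; exact abs_add_le _ _
    _ ≤ 1 * 1 + 1 := by
        rw [abs_of_nonneg h.1]
        exact add_le_add (mul_le_mul h1 h.2 h.1 zero_le_one) h2
    _ = 2 := by norm_num

lemma abs_sin_sub_sin_le (a b : ℝ) : |Real.sin a - Real.sin b| ≤ |a - b| := by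
  have h := Real.lipschitzWith_sin.dist_le_mul a b
  simpa [Real.dist_eq] using h

lemma abs_bracket_le_mul {t : ℝ} (ht : t ∈ Icc 0 (Real.pi / 2)) (x : ℝ) (n : ℕ) :
    |bracket x n t| ≤ (|x| + n + 1) * t := by
  have h := decay_pow_mem ht n
  have h0 := one_sub_decay_pow_le ht n
  have h1 := abs_sin_sub_sin_le (x * t - Real.pi / 4) (-(Real.pi / 4))
  have h2 := abs_sin_sub_sin_le (t / 2 + Real.pi / 4) (Real.pi / 4)
  have h3 := Real.abs_sin_le_one (Real.pi / 4)
  have e1 : |x * t - Real.pi / 4 - -(Real.pi / 4)| = |x| * t := by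
    rw [show x * t - Real.pi / 4 - -(Real.pi / 4) = x * t by ring, abs_mul, abs_of_nonneg ht.1]
  have e2 : |t / 2 + Real.pi / 4 - Real.pi / 4| = t / 2 := by
    rw [show t / 2 + Real.pi / 4 - Real.pi / 4 = t / 2 by ring,
      abs_of_nonneg (by linarith [ht.1])]
  rw [e1] at h1
  rw [e2] at h2
  have key : bracket x n t =
      (Real.sin (x * t - Real.pi / 4) - Real.sin (-(Real.pi / 4))) * decay t ^ n
      + Real.sin (Real.pi / 4) * (1 - decay t ^ n)
      + (Real.sin (t / 2 + Real.pi / 4) - Real.sin (Real.pi / 4)) := by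
    rw [bracket, Real.sin_neg]; ring
  rw [key]
  calc _ ≤ |Real.sin (x * t - Real.pi / 4) - Real.sin (-(Real.pi / 4))| * |decay t ^ n|
      + |Real.sin (Real.pi / 4)| * |1 - decay t ^ n|
      + |Real.sin (t / 2 + Real.pi / 4) - Real.sin (Real.pi / 4)| := by
        rw [← abs_mul, ← abs_mul]
        exact (abs_add_le _ _).trans (by gcongr; exact abs_add_le _ _)
    _ ≤ |x| * t * 1 + 1 * (n * t) + t / 2 := by
        rw [abs_of_nonneg h.1, abs_of_nonneg (sub_nonneg.2 h.2)]
        have := h.1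
        have := h.2
        have := ht.1
        gcongr
    _ ≤ (|x| + n + 1) * t := by nlinarith [ht.1]

lemma sin_rpow_le {t r : ℝ} (ht : t ∈ Ioc 0 (Real.pi / 2)) (hr : r ≤ 0) :
    Real.sin t ^ r ≤ (2 / Real.pi) ^ r * t ^ r := by
  have hp : 0 < 2 / Real.pi := by positivity
  rw [← Real.mul_rpow hp.le ht.1.le]
  exact Real.rpow_le_rpow_of_nonpos (mul_pos hp ht.1) (Real.mul_le_sin ht.1.le ht.2) hr

lemma integrable_of_norm_le {E : Type*} [NormedAddCommGroup E] {f : ℝ → E} {C r : ℝ}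
    (hr : -1 < r) (hf : AEStronglyMeasurable f (volume.restrict (Ioc 0 (Real.pi / 2))))
    (hC : ∀ t ∈ Ioc 0 (Real.pi / 2), ‖f t‖ ≤ C * t ^ r) :
    IntervalIntegrable f volume 0 (Real.pi / 2) := by
  have hp : (0 : ℝ) ≤ Real.pi / 2 := by positivity
  have h := (intervalIntegral.intervalIntegrable_rpow' (a := 0) (b := Real.pi / 2) hr).const_mul C
  rw [intervalIntegrable_iff_integrableOn_Ioc_of_le hp] at h ⊢
  refine Integrable.mono' h hf ?_
  exact (ae_restrict_iff' measurableSet_Ioc).2 (Eventually.of_forall hC)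

/-- The integrand of the integral representation. -/
def sqrtKernel (x : ℝ) (n : ℕ) (t : ℝ) : ℝ :=
  Real.sin t ^ (-(3 / 2) : ℝ) * bracket x n t

lemma measurable_sqrtKernel (x : ℝ) (n : ℕ) : Measurable (sqrtKernel x n) :=
  (Real.measurable_sin.pow_const _).mul (measurable_bracket x n)

lemma integrable_sqrtKernel (x : ℝ) (n : ℕ) :
    IntervalIntegrable (sqrtKernel x n) volume 0 (Real.pi / 2) := by
  refine integrable_of_norm_le (r := -(1 / 2)) (C := (2 / Real.pi) ^ (-(3 / 2) : ℝ) * (|x| + n + 1))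
    (by norm_num) (measurable_sqrtKernel x n).aestronglyMeasurable fun t ht => ?_
  have h1 := sin_rpow_le ht (r := -(3 / 2)) (by norm_num)
  have h2 := abs_bracket_le_mul (Ioc_subset_Icc_self ht) x n
  have h3 : t ^ (-(1 / 2) : ℝ) = t ^ (-(3 / 2) : ℝ) * t := by
    rw [← Real.rpow_add_one ht.1.ne']; norm_num
  rw [sqrtKernel, Real.norm_eq_abs, abs_mul,
    abs_of_nonneg (Real.rpow_nonneg (sin_pos_of_mem ht).le _), h3]
  calc _ ≤ ((2 / Real.pi) ^ (-(3 / 2) : ℝ) * t ^ (-(3 / 2) : ℝ)) * ((|x| + n + 1) * t) :=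
        mul_le_mul h1 h2 (abs_nonneg _)
          (mul_nonneg (by positivity) (Real.rpow_nonneg ht.1.le _))
    _ = _ := by ring

/-- The integral `∫₀^{π/2} (sin t)^(-3/2) (sin(xt - π/4) u(t)ⁿ + sin(t/2 + π/4)) dt`, which is up to
a constant factor the real part of the discrete square root at `x + in`. -/
def sqrtIntegral (x : ℝ) (n : ℕ) : ℝ := ∫ t in (0 : ℝ)..(Real.pi / 2), sqrtKernel x n t

lemma sqrtIntegral_neg_half : sqrtIntegral (-(1 / 2)) 0 = 0 := by
  have : ∀ t, sqrtKernel (-(1 / 2)) 0 t = 0 := fun t => by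
    rw [sqrtKernel, bracket, show -(1 / 2) * t - Real.pi / 4 = -(t / 2 + Real.pi / 4) by ring,
      Real.sin_neg]
    ring
  simp only [sqrtIntegral, this, intervalIntegral.integral_zero]

lemma integral_congr_Ioc {E : Type*} [NormedAddCommGroup E] [NormedSpace ℝ E] {f g : ℝ → E}
    (h : ∀ t ∈ Ioc 0 (Real.pi / 2), f t = g t) :
    ∫ t in (0 : ℝ)..(Real.pi / 2), f t = ∫ t in (0 : ℝ)..(Real.pi / 2), g t :=
  intervalIntegral.integral_congr_ae (Eventually.of_forall fun t ht =>
    h t (by rwa [uIoc_of_le (by positivity)] at ht))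

/-- The discrete Cauchy–Riemann equations on a square; `sqrtIntegral (-x)` plays the role of the
imaginary part. -/
lemma sqrtIntegral_cauchyRiemann (x : ℝ) (n : ℕ) :
    sqrtIntegral (x + 1) n - sqrtIntegral x (n + 1)
      = sqrtIntegral (-(x + 1)) (n + 1) - sqrtIntegral (-x) n ∧
    sqrtIntegral (x + 1) (n + 1) - sqrtIntegral x n
      = sqrtIntegral (-x) (n + 1) - sqrtIntegral (-(x + 1)) n := by
  have hi := integrable_sqrtKernel
  simp only [sqrtIntegral]
  rw [← intervalIntegral.integral_sub (hi _ _) (hi _ _),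
    ← intervalIntegral.integral_sub (hi _ _) (hi _ _),
    ← intervalIntegral.integral_sub (hi _ _) (hi _ _),
    ← intervalIntegral.integral_sub (hi _ _) (hi _ _)]
  refine ⟨integral_congr_Ioc fun t ht => ?_, integral_congr_Ioc fun t ht => ?_⟩
  all_goals
    have hu := decay_mul_one_add_sin (Ioc_subset_Icc_self ht)
    have hc := decay_mul_cos (Ioc_subset_Icc_self ht)
    have e1 : (x + 1) * t - Real.pi / 4 = x * t + t - Real.pi / 4 := by ring
    have e2 : -(x + 1) * t - Real.pi / 4 = -(x * t + t + Real.pi / 4) := by ring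
    have e3 : -x * t - Real.pi / 4 = -(x * t + Real.pi / 4) := by ring
    simp only [sqrtKernel, bracket, e1, e2, e3, Real.sin_neg, Real.sin_sub, Real.sin_add,
      Real.cos_add, Real.cos_pi_div_four, Real.sin_pi_div_four, pow_succ]
  · linear_combination (Real.sin t ^ (-(3 / 2) : ℝ) * decay t ^ n * (√2 / 2))
      * ((Real.sin (x * t) + Real.cos (x * t)) * hc + (Real.cos (x * t) - Real.sin (x * t)) * hu)
  · linear_combination (Real.sin t ^ (-(3 / 2) : ℝ) * decay t ^ n * (√2 / 2))
      * ((Real.sin (x * t) - Real.cos (x * t)) * hc + (Real.sin (x * t) + Real.cos (x * t)) * hu)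

/-- Discrete harmonicity off the real axis. -/
lemma sqrtIntegral_harmonic (x : ℝ) (n : ℕ) :
    sqrtIntegral (x + 1) (n + 2) + sqrtIntegral (x - 1) (n + 2) + sqrtIntegral (x + 1) n
      + sqrtIntegral (x - 1) n = 4 * sqrtIntegral x (n + 1) := by
  have h1 := (sqrtIntegral_cauchyRiemann x n).1
  have h2 := (sqrtIntegral_cauchyRiemann (x - 1) n).2
  have h3 := (sqrtIntegral_cauchyRiemann x (n + 1)).2
  have h4 := (sqrtIntegral_cauchyRiemann (x - 1) (n + 1)).1
  ring_nf at h1 h2 h3 h4 ⊢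
  linarith

/-! ### Horizontal differences and the values on the real axis -/

/-- The integrand for the horizontal differences of `sqrtIntegral`. -/
def stepKernel (y : ℝ) (n : ℕ) (t : ℝ) : ℝ :=
  Real.sin t ^ (-(1 / 2) : ℝ) * (Real.cos (y * t - Real.pi / 4) * decay t ^ n)

lemma integrable_sin_rpow_mul {E : Type*} [NormedAddCommGroup E] [NormedSpace ℝ E] {f : ℝ → E}
    {C : ℝ} (hf : AEStronglyMeasurable f (volume.restrict (Ioc 0 (Real.pi / 2))))
    (hC : ∀ t ∈ Ioc 0 (Real.pi / 2), ‖f t‖ ≤ C) :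
    IntervalIntegrable (fun t => Real.sin t ^ (-(1 / 2) : ℝ) • f t) volume 0 (Real.pi / 2) := by
  refine integrable_of_norm_le (r := -(1 / 2)) (C := (2 / Real.pi) ^ (-(1 / 2) : ℝ) * C)
    (by norm_num) ((Real.measurable_sin.pow_const _).aestronglyMeasurable.smul hf) fun t ht => ?_
  have h1 := sin_rpow_le ht (r := -(1 / 2)) (by norm_num)
  rw [norm_smul, Real.norm_eq_abs, abs_of_nonneg (Real.rpow_nonneg (sin_pos_of_mem ht).le _)]
  calc _ ≤ ((2 / Real.pi) ^ (-(1 / 2) : ℝ) * t ^ (-(1 / 2) : ℝ)) * C :=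
        mul_le_mul h1 (hC t ht) (norm_nonneg _)
          (mul_nonneg (by positivity) (Real.rpow_nonneg ht.1.le _))
    _ = _ := by ring

lemma abs_cos_mul_decay_le {t : ℝ} (ht : t ∈ Ioc 0 (Real.pi / 2)) (s : ℝ) (n : ℕ) :
    |Real.cos s * decay t ^ n| ≤ decay t ^ n := by
  have h := decay_pow_mem (Ioc_subset_Icc_self ht) n
  rw [abs_mul, abs_of_nonneg h.1]
  exact mul_le_of_le_one_left h.1 (Real.abs_cos_le_one s)

lemma integrable_stepKernel (y : ℝ) (n : ℕ) :
    IntervalIntegrable (stepKernel y n) volume 0 (Real.pi / 2) := by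
  have := measurable_decay
  exact integrable_sin_rpow_mul (f := fun t => Real.cos (y * t - Real.pi / 4) * decay t ^ n)
    (C := 1) (by fun_prop) fun t ht =>
    (abs_cos_mul_decay_le ht _ n).trans (decay_pow_mem (Ioc_subset_Icc_self ht) n).2

/-- The integral `∫₀^{π/2} (sin t)^(-1/2) cos(yt - π/4) u(t)ⁿ dt`: half the difference of
`sqrtIntegral` between `y + 1` and `y - 1`. -/
def stepIntegral (y : ℝ) (n : ℕ) : ℝ := ∫ t in (0 : ℝ)..(Real.pi / 2), stepKernel y n t

lemma sqrtIntegral_sub (y : ℝ) (n : ℕ) :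
    sqrtIntegral (y + 1) n - sqrtIntegral (y - 1) n = 2 * stepIntegral y n := by
  have hi := integrable_sqrtKernel
  simp only [sqrtIntegral, stepIntegral]
  rw [← intervalIntegral.integral_sub (hi _ _) (hi _ _), ← intervalIntegral.integral_const_mul]
  refine integral_congr_Ioc fun t ht => ?_
  have h : Real.sin t ^ (-(1 / 2) : ℝ) = Real.sin t ^ (-(3 / 2) : ℝ) * Real.sin t := by
    rw [← Real.rpow_add_one (sin_pos_of_mem ht).ne']; norm_num
  have e1 : (y + 1) * t - Real.pi / 4 = (y * t - Real.pi / 4) + t := by ring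
  have e2 : (y - 1) * t - Real.pi / 4 = (y * t - Real.pi / 4) - t := by ring
  simp only [sqrtKernel, stepKernel, bracket, e1, e2, h, Real.sin_add _ t, Real.sin_sub _ t]
  ring

/-- The recursion comes from integrating the derivative of `(sin t)^(1/2) sin((2k + 3/2)t - 3π/4)`,
which vanishes at both ends `0` and `π/2`. -/
lemma stepIntegral_recursion (k : ℤ) :
    (2 * k + 1) * stepIntegral (2 * k + 1 / 2) 0
      = (2 * k + 2) * stepIntegral (2 * k + 5 / 2) 0 := by
  have hp : (0 : ℝ) ≤ Real.pi / 2 := by positivity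
  have hi := integrable_stepKernel
  have key : ∫ t in (0 : ℝ)..(Real.pi / 2), ((2 * k + 1) / 2 * stepKernel (2 * k + 1 / 2) 0 t
      - (2 * k + 2) / 2 * stepKernel (2 * k + 5 / 2) 0 t) = 0 := by
    have := intervalIntegral.integral_eq_sub_of_hasDerivAt_of_le (a := 0) (b := Real.pi / 2)
      (f := fun t => Real.sin t ^ (1 / 2 : ℝ)
        * Real.sin ((2 * k + 3 / 2) * t - 3 * Real.pi / 4))
      (f' := fun t => (2 * k + 1) / 2 * stepKernel (2 * k + 1 / 2) 0 t
        - (2 * k + 2) / 2 * stepKernel (2 * k + 5 / 2) 0 t) hp ?_ ?_ ?_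
    · rw [this]
      have e : (2 * (k : ℝ) + 3 / 2) * (Real.pi / 2) - 3 * Real.pi / 4 = k * Real.pi := by ring
      simp [e, Real.sin_int_mul_pi]
    · refine ContinuousOn.mul (Continuous.continuousOn ?_) (by fun_prop)
      exact Real.continuous_sin.rpow_const fun _ => Or.inr (by norm_num)
    · intro t ht
      have hs := sin_pos_of_mem (Ioo_subset_Ioc_self ht)
      have d1 := (Real.hasDerivAt_sin t).rpow_const (p := 1 / 2) (Or.inl hs.ne')
      have d2 : HasDerivAt (fun t => Real.sin ((2 * k + 3 / 2) * t - 3 * Real.pi / 4))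
          (Real.cos ((2 * k + 3 / 2) * t - 3 * Real.pi / 4) * ((2 * k + 3 / 2) * 1)) t :=
        (((hasDerivAt_id t).const_mul _).sub_const _).sin
      refine (d1.mul d2).congr_deriv ?_
      have h1 : Real.sin t ^ (1 / 2 : ℝ) = Real.sin t ^ (-(1 / 2) : ℝ) * Real.sin t := by
        rw [← Real.rpow_add_one hs.ne']; norm_num
      have h2 : Real.sin t ^ (1 / 2 - 1 : ℝ) = Real.sin t ^ (-(1 / 2) : ℝ) := by norm_num
      have e0 : (2 * k + 3 / 2) * t - 3 * Real.pi / 4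
          = ((2 * k + 3 / 2) * t - Real.pi / 4) - Real.pi / 2 := by ring
      have e1 : (2 * k + 1 / 2) * t - Real.pi / 4
          = ((2 * k + 3 / 2) * t - Real.pi / 4) - t := by ring
      have e2 : (2 * k + 5 / 2) * t - Real.pi / 4
          = ((2 * k + 3 / 2) * t - Real.pi / 4) + t := by ring
      rw [h1, h2, e0, Real.sin_sub_pi_div_two, Real.cos_sub_pi_div_two]
      simp only [stepKernel, e1, e2, pow_zero, mul_one, Real.cos_sub _ t, Real.cos_add _ t]
      ring
    · exact ((hi _ _).const_mul _).sub ((hi _ _).const_mul _)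
  rw [intervalIntegral.integral_sub ((hi _ _).const_mul _) ((hi _ _).const_mul _),
    intervalIntegral.integral_const_mul, intervalIntegral.integral_const_mul] at key
  simp only [stepIntegral]
  linarith

lemma stepIntegral_half_pos : 0 < stepIntegral (1 / 2) 0 := by
  refine intervalIntegral.intervalIntegral_pos_of_pos_on (integrable_stepKernel _ _)
    (fun t ht => ?_) (by positivity)
  refine mul_pos (Real.rpow_pos_of_pos (sin_pos_of_mem (Ioo_subset_Ioc_self ht)) _) ?_
  rw [pow_zero, mul_one]
  have := ht.1
  have := ht.2
  exact Real.cos_pos_of_mem_Ioo ⟨by linarith [Real.pi_pos], by linarith [Real.pi_pos]⟩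

lemma sqrtIntegral_tip : sqrtIntegral (3 / 2) 0 = 2 * stepIntegral (1 / 2) 0 := by
  have h := sqrtIntegral_sub (1 / 2) 0
  rw [show (1 / 2 - 1 : ℝ) = -(1 / 2) by norm_num, sqrtIntegral_neg_half] at h
  rw [← h]
  norm_num

lemma sqrtIntegral_tip_pos : 0 < sqrtIntegral (3 / 2) 0 := by
  rw [sqrtIntegral_tip]
  linarith [stepIntegral_half_pos]

lemma stepIntegral_of_neg (k : ℕ) : stepIntegral (2 * (-1 - k : ℤ) + 1 / 2) 0 = 0 := by
  induction k with
  | zero =>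
    have h := stepIntegral_recursion (-1)
    push_cast at h ⊢
    rw [show (2 * (-1) + 2 : ℝ) = 0 by norm_num, zero_mul] at h
    linarith
  | succ k ih =>
    have h := stepIntegral_recursion (-1 - (k + 1 : ℕ))
    push_cast at h ih ⊢
    rw [show (2 * (-1 - (k + 1)) + 5 / 2 : ℝ) = 2 * (-1 - k) + 1 / 2 by ring, ih, mul_zero] at h
    refine (mul_eq_zero.1 h).resolve_left ?_
    have : (0 : ℝ) ≤ k := Nat.cast_nonneg k
    intro h
    linarith

/-- On the negative half-axis the discrete square root vanishes. -/
lemma sqrtIntegral_of_neg (k : ℕ) : sqrtIntegral (-(2 * k + 1 / 2)) 0 = 0 := by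
  induction k with
  | zero => simpa using sqrtIntegral_neg_half
  | succ k ih =>
    have h := sqrtIntegral_sub (-(2 * k + 1 / 2) - 1) 0
    have h2 := stepIntegral_of_neg k
    push_cast at h2 ⊢
    rw [show (2 * (-1 - k) + 1 / 2 : ℝ) = -(2 * k + 1 / 2) - 1 by ring] at h2
    rw [h2, sub_add_cancel, ih] at h
    rw [show (-(2 * (k + 1) + 1 / 2) : ℝ) = -(2 * k + 1 / 2) - 1 - 1 by ring]
    linarith

/-- On the positive half-axis the sum of the steps is an explicit multiple of the last step. The
steps are proportional to `(2k).choose k / 4 ^ k`, but this relation makes their asymptotics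
unnecessary. -/
lemma sqrtIntegral_of_nonneg (k : ℕ) :
    sqrtIntegral (2 * k + 3 / 2) 0 = (2 * k + 1) * (2 * stepIntegral (2 * k + 1 / 2) 0) := by
  induction k with
  | zero => simpa using sqrtIntegral_tip
  | succ k ih =>
    have h := sqrtIntegral_sub (2 * k + 5 / 2) 0
    have h2 := stepIntegral_recursion k
    push_cast at h2 ⊢
    rw [show (2 * k + 5 / 2 - 1 : ℝ) = 2 * k + 3 / 2 by ring, ih] at h
    rw [show (2 * (k + 1) + 3 / 2 : ℝ) = 2 * k + 5 / 2 + 1 by ring,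
      show (2 * (k + 1) + 1 / 2 : ℝ) = 2 * k + 5 / 2 by ring]
    linarith

/-! ### Decay at infinity -/

/-- The Riemann–Lebesgue lemma for oscillating integrals with a varying phase. -/
lemma tendsto_integral_mul_cos {f φ : ℝ → ℝ} (hf : IntervalIntegrable f volume 0 (Real.pi / 2))
    (hφ : Measurable φ) :
    Tendsto (fun m : ℤ => ∫ t in (0 : ℝ)..(Real.pi / 2), f t * Real.cos (m * t + φ t))
      cofinite (𝓝 0) := by
  have hp : (0 : ℝ) ≤ Real.pi / 2 := by positivity
  rw [intervalIntegrable_iff_integrableOn_Ioc_of_le hp] at hf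
  have hf' : IntegrableOn (fun t => (f t : ℂ)) (Ioc 0 (Real.pi / 2)) := hf.ofReal
  have hRL := Real.tendsto_integral_exp_smul_cocompact
    ((Ioc 0 (Real.pi / 2)).indicator fun t => (f t : ℂ) * exp (φ t * I))
  have hmap : Tendsto (fun m : ℤ => -(m : ℝ) / (2 * Real.pi)) cofinite (cocompact ℝ) := by
    have h1 : Tendsto (fun m : ℤ => (m : ℝ)) cofinite (cocompact ℝ) := Int.tendsto_coe_cofinite
    have h2 : Tendsto (fun x : ℝ => x * (-(2 * Real.pi)⁻¹)) (cocompact ℝ) (cocompact ℝ) :=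
      (Homeomorph.mulRight₀ (-(2 * Real.pi)⁻¹)
        (by simp [Real.pi_ne_zero])).isClosedEmbedding.tendsto_cocompact
    refine (h2.comp h1).congr fun m => ?_
    simp only [Function.comp]
    ring
  have h := (continuous_re.tendsto 0).comp (hRL.comp hmap)
  rw [zero_re] at h
  refine h.congr fun m => ?_
  simp only [Function.comp]
  have e : ∀ v : ℝ, Real.fourierChar (-(v * (-(m : ℝ) / (2 * Real.pi)))) •
      (Ioc 0 (Real.pi / 2)).indicator (fun t => (f t : ℂ) * exp (φ t * I)) v
      = (Ioc 0 (Real.pi / 2)).indicator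
        (fun t => (f t : ℂ) * exp ((m * t + φ t : ℝ) * I)) v := by
    intro v
    by_cases hv : v ∈ Ioc 0 (Real.pi / 2)
    · rw [indicator_of_mem hv, indicator_of_mem hv, Circle.smul_def, Real.fourierChar_apply,
        smul_eq_mul, mul_left_comm, ← Complex.exp_add]
      congr 2
      have : (Real.pi : ℂ) ≠ 0 := by exact_mod_cast Real.pi_ne_zero
      push_cast
      field_simp
    · rw [indicator_of_notMem hv, indicator_of_notMem hv, smul_zero]
  simp only [e]
  rw [integral_indicator measurableSet_Ioc, intervalIntegral.integral_of_le hp]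
  have hint : IntegrableOn (fun t : ℝ => (f t : ℂ) * exp ((m * t + φ t : ℝ) * I))
      (Ioc 0 (Real.pi / 2)) := by
    refine Integrable.mono hf' (hf'.aestronglyMeasurable.mul
      (Measurable.aestronglyMeasurable (by fun_prop))) (Eventually.of_forall fun t => ?_)
    rw [norm_mul, norm_exp_ofReal_mul_I, mul_one]
  have := integral_re hint
  simp only [RCLike.re_eq_complex_re] at this
  rw [← this]
  refine setIntegral_congr_fun measurableSet_Ioc fun t _ => ?_
  simp only [re_ofReal_mul, exp_ofReal_mul_I_re]

lemma tendsto_stepIntegral_row (c : ℝ) (n : ℕ) :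
    Tendsto (fun m : ℤ => stepIntegral (m + c) n) cofinite (𝓝 0) := by
  have hm := measurable_decay
  have hf := integrable_sin_rpow_mul (f := fun t => decay t ^ n) (C := 1) (by fun_prop)
    fun t ht => by
      have h := decay_pow_mem (Ioc_subset_Icc_self ht) n
      rw [Real.norm_eq_abs, abs_of_nonneg h.1]; exact h.2
  refine (tendsto_integral_mul_cos hf (φ := fun t => c * t - Real.pi / 4)
    (by fun_prop)).congr fun m => integral_congr_Ioc fun t _ => ?_
  rw [stepKernel, smul_eq_mul, show (m : ℝ) * t + (c * t - Real.pi / 4)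
    = (m + c) * t - Real.pi / 4 by ring]
  ring

/-- Far from the real axis the steps are small, uniformly along rows. -/
lemma exists_abs_stepIntegral_lt {ε : ℝ} (hε : 0 < ε) :
    ∃ N : ℕ, ∀ n ≥ N, ∀ y, |stepIntegral y n| < ε := by
  have hp : (0 : ℝ) ≤ Real.pi / 2 := by positivity
  have hm := measurable_decay
  have hi : ∀ n : ℕ, IntervalIntegrable (fun t => Real.sin t ^ (-(1 / 2) : ℝ) • decay t ^ n)
      volume 0 (Real.pi / 2) := fun n =>
    integrable_sin_rpow_mul (f := fun t => decay t ^ n) (C := 1) (by fun_prop) fun t ht => by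
      have h := decay_pow_mem (Ioc_subset_Icc_self ht) n
      rw [Real.norm_eq_abs, abs_of_nonneg h.1]; exact h.2
  have hlim : Tendsto (fun n : ℕ => ∫ t in (0 : ℝ)..(Real.pi / 2),
      Real.sin t ^ (-(1 / 2) : ℝ) • decay t ^ n) atTop
      (𝓝 (∫ _ in (0 : ℝ)..(Real.pi / 2), (0 : ℝ))) := by
    refine intervalIntegral.tendsto_integral_filter_of_dominated_convergence
      (fun t => Real.sin t ^ (-(1 / 2) : ℝ) • decay t ^ 0) ?_ ?_ (hi 0) ?_
    · refine Eventually.of_forall fun n => ?_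
      rw [uIoc_of_le hp]
      exact ((intervalIntegrable_iff_integrableOn_Ioc_of_le hp).1 (hi n)).aestronglyMeasurable
    · refine Eventually.of_forall fun n => Eventually.of_forall fun t ht => ?_
      rw [uIoc_of_le hp] at ht
      have h := decay_pow_mem (Ioc_subset_Icc_self ht) n
      have h2 := Real.rpow_nonneg (sin_pos_of_mem ht).le (-(1 / 2))
      rw [smul_eq_mul, smul_eq_mul, pow_zero, Real.norm_eq_abs, abs_of_nonneg (mul_nonneg h2 h.1)]
      exact mul_le_mul_of_nonneg_left h.2 h2
    · refine Eventually.of_forall fun t ht => ?_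
      rw [uIoc_of_le hp] at ht
      have := tendsto_pow_atTop_nhds_zero_of_lt_one (decay_nonneg (Ioc_subset_Icc_self ht))
        (decay_lt_one ht)
      simpa using this.const_mul (Real.sin t ^ (-(1 / 2) : ℝ))
  rw [intervalIntegral.integral_zero] at hlim
  obtain ⟨N, hN⟩ := eventually_atTop.1 (hlim.eventually (gt_mem_nhds hε))
  refine ⟨N, fun n hn y => lt_of_le_of_lt ?_ (hN n hn)⟩
  rw [← Real.norm_eq_abs, stepIntegral]
  refine intervalIntegral.norm_integral_le_of_norm_le hp
    (Eventually.of_forall fun t ht => ?_) (hi n)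
  rw [stepKernel, norm_mul, Real.norm_eq_abs, Real.norm_eq_abs,
    abs_of_nonneg (Real.rpow_nonneg (sin_pos_of_mem ht).le _), smul_eq_mul]
  exact mul_le_mul_of_nonneg_left (abs_cos_mul_decay_le ht _ n)
    (Real.rpow_nonneg (sin_pos_of_mem ht).le _)

/-- The values of `sqrtIntegral` at neighbouring points of two consecutive rows get close to each
other far to the left and far to the right. -/
lemma tendsto_sqrtIntegral_sub_row (c : ℝ) (n : ℕ) :
    Tendsto (fun m : ℤ => sqrtIntegral (m + c + 1) n - sqrtIntegral (m + c) (n + 1))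
      cofinite (𝓝 0) := by
  have hm := measurable_decay
  -- Both coefficients carry a factor `O(t)`, which makes `(sin t)^(-3/2)` integrable.
  have hbd : ∀ g : ℝ → ℝ, Measurable g → (∀ t ∈ Ioc 0 (Real.pi / 2), |g t| ≤ 2 * t) →
      IntervalIntegrable (fun t => Real.sin t ^ (-(3 / 2) : ℝ) * (g t * decay t ^ n)) volume 0
        (Real.pi / 2) := by
    intro g hg hgt
    refine integrable_of_norm_le (r := -(1 / 2)) (C := (2 / Real.pi) ^ (-(3 / 2) : ℝ) * 2)
      (by norm_num) (Measurable.aestronglyMeasurable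
        ((Real.measurable_sin.pow_const _).mul (by fun_prop))) fun t ht => ?_
    have h1 := sin_rpow_le ht (r := -(3 / 2)) (by norm_num)
    have h := decay_pow_mem (Ioc_subset_Icc_self ht) n
    have h3 : t ^ (-(1 / 2) : ℝ) = t ^ (-(3 / 2) : ℝ) * t := by
      rw [← Real.rpow_add_one ht.1.ne']; norm_num
    rw [Real.norm_eq_abs, abs_mul, abs_mul,
      abs_of_nonneg (Real.rpow_nonneg (sin_pos_of_mem ht).le _), abs_of_nonneg h.1, h3]
    calc _ ≤ ((2 / Real.pi) ^ (-(3 / 2) : ℝ) * t ^ (-(3 / 2) : ℝ)) * ((2 * t) * 1) :=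
          mul_le_mul h1 (mul_le_mul (hgt t ht) h.2 h.1 (by linarith [ht.1]))
            (mul_nonneg (abs_nonneg _) h.1)
            (mul_nonneg (by positivity) (Real.rpow_nonneg ht.1.le _))
      _ = _ := by ring
  have hi1 := hbd (fun t => Real.cos t - decay t) (by fun_prop) fun t ht => by
    have h1 := one_sub_decay_le (Ioc_subset_Icc_self ht)
    have h2 := decay_le_one (Ioc_subset_Icc_self ht)
    have h3 := decay_mul_one_add_sin (Ioc_subset_Icc_self ht)
    have h4 := decay_nonneg (Ioc_subset_Icc_self ht)
    have h5 := sin_pos_of_mem ht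
    have h6 := Real.sin_le ht.1.le
    rw [abs_le]
    constructor <;> nlinarith
  have hi2 := hbd Real.sin Real.measurable_sin fun t ht => by
    rw [abs_of_pos (sin_pos_of_mem ht)]
    linarith [Real.sin_le ht.1.le, ht.1]
  have h1 := tendsto_integral_mul_cos hi1 (φ := fun t => c * t - Real.pi / 4 - Real.pi / 2)
    (by fun_prop)
  have h2 := tendsto_integral_mul_cos hi2 (φ := fun t => c * t - Real.pi / 4) (by fun_prop)
  have h := h1.add h2
  rw [add_zero] at h
  refine h.congr fun m => ?_
  have hc : ∀ {f φ : ℝ → ℝ}, IntervalIntegrable f volume 0 (Real.pi / 2) → Continuous φ →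
      IntervalIntegrable (fun t => f t * Real.cos (m * t + φ t)) volume 0 (Real.pi / 2) :=
    fun hf hφ => hf.mul_continuousOn (by fun_prop)
  simp only [sqrtIntegral]
  rw [← intervalIntegral.integral_sub (integrable_sqrtKernel _ _) (integrable_sqrtKernel _ _),
    ← intervalIntegral.integral_add (hc hi1 (by fun_prop)) (hc hi2 (by fun_prop))]
  refine integral_congr_Ioc fun t _ => ?_
  have e1 : (m : ℝ) * t + (c * t - Real.pi / 4 - Real.pi / 2)
      = ((m + c) * t - Real.pi / 4) - Real.pi / 2 := by ring
  have e2 : (m : ℝ) * t + (c * t - Real.pi / 4) = (m + c) * t - Real.pi / 4 := by ring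
  have e3 : (m + c + 1 : ℝ) * t - Real.pi / 4 = ((m + c) * t - Real.pi / 4) + t := by ring
  simp only [e1, e2, Real.cos_sub_pi_div_two, sqrtKernel, bracket, e3, Real.sin_add _ t, pow_succ]
  ring

/-! ### The discrete square root on the lattice and its horizontal differences -/

/-- The real part of the discrete square root at the lattice point `(m + 1/2) + in` of the upper
half-plane, for `m + n` odd (so that `m + 1/2 + in` is a corner of type `1`), normalised by its value
at the tip `3/2`. Its imaginary part at a corner `(m + 1/2) + in` of type `i` is
`discreteSqrt (-1 - m) n`, by symmetry with respect to the imaginary axis. -/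
def discreteSqrt (m : ℤ) (n : ℕ) : ℝ := sqrtIntegral (m + 1 / 2) n / sqrtIntegral (3 / 2) 0

lemma discreteSqrt_one_zero : discreteSqrt 1 0 = 1 := by
  rw [discreteSqrt, show (((1 : ℤ) : ℝ) + 1 / 2) = 3 / 2 by norm_num]
  exact div_self sqrtIntegral_tip_pos.ne'

lemma discreteSqrt_cauchyRiemann (m : ℤ) (n : ℕ) :
    discreteSqrt (m + 1) n - discreteSqrt m (n + 1)
      = discreteSqrt (-2 - m) (n + 1) - discreteSqrt (-1 - m) n ∧
    discreteSqrt (m + 1) (n + 1) - discreteSqrt m n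
      = discreteSqrt (-1 - m) (n + 1) - discreteSqrt (-2 - m) n := by
  have h := sqrtIntegral_cauchyRiemann (m + 1 / 2) n
  have e1 : (((m + 1 : ℤ) : ℝ) + 1 / 2) = m + 1 / 2 + 1 := by push_cast; ring
  have e2 : (((-2 - m : ℤ) : ℝ) + 1 / 2) = -(m + 1 / 2 + 1) := by push_cast; ring
  have e3 : (((-1 - m : ℤ) : ℝ) + 1 / 2) = -(m + 1 / 2) := by push_cast; ring
  simp only [discreteSqrt, e1, e2, e3]
  constructor
  · rw [← sub_div, ← sub_div, h.1]
  · rw [← sub_div, ← sub_div, h.2]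

lemma discreteSqrt_harmonic (m : ℤ) (n : ℕ) :
    discreteSqrt (m + 1) (n + 2) + discreteSqrt (m - 1) (n + 2) + discreteSqrt (m + 1) n
      + discreteSqrt (m - 1) n = 4 * discreteSqrt m (n + 1) := by
  have h := sqrtIntegral_harmonic (m + 1 / 2) n
  have e1 : (((m + 1 : ℤ) : ℝ) + 1 / 2) = m + 1 / 2 + 1 := by push_cast; ring
  have e2 : (((m - 1 : ℤ) : ℝ) + 1 / 2) = m + 1 / 2 - 1 := by push_cast; ring
  simp only [discreteSqrt, e1, e2]
  rw [← add_div, ← add_div, ← add_div, h, mul_div_assoc]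

lemma discreteSqrt_of_neg {m : ℤ} (hm : Odd m) (h0 : m < 0) : discreteSqrt m 0 = 0 := by
  obtain ⟨k, rfl⟩ := hm
  obtain ⟨j, rfl⟩ : ∃ j : ℕ, k = -1 - j := ⟨(-1 - k).toNat, by omega⟩
  have h := sqrtIntegral_of_neg j
  rw [discreteSqrt, show (((2 * (-1 - j) + 1 : ℤ) : ℝ) + 1 / 2) = -(2 * j + 1 / 2) by
    push_cast; ring, h, zero_div]

/-- Harmonicity on the positive half-axis for the extension by reflection. -/
lemma discreteSqrt_harmonic_axis {m : ℤ} (hm : Odd m) (h0 : 0 < m) :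
    discreteSqrt (m + 1) 1 + discreteSqrt (m - 1) 1 = 2 * discreteSqrt m 0 := by
  have h1 := (discreteSqrt_cauchyRiemann m 0).2
  have h2 := (discreteSqrt_cauchyRiemann (m - 1) 0).1
  have z1 : discreteSqrt (-2 - m) 0 = 0 := discreteSqrt_of_neg (by grind) (by omega)
  have z2 : discreteSqrt (-1 - (m - 1)) 0 = 0 := discreteSqrt_of_neg (by grind) (by omega)
  have e1 : -2 - (m - 1) = -1 - m := by ring
  rw [sub_add_cancel, e1, z2] at h2
  rw [z1] at h1
  simp only [zero_add] at h1 h2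
  linarith

lemma tendsto_discreteSqrt_sub_row (n : ℕ) :
    Tendsto (fun m : ℤ => discreteSqrt (m + 1) n - discreteSqrt m (n + 1)) cofinite (𝓝 0) := by
  have h := (tendsto_sqrtIntegral_sub_row (1 / 2) n).div_const (sqrtIntegral (3 / 2) 0)
  rw [zero_div] at h
  refine h.congr fun m => ?_
  rw [discreteSqrt, discreteSqrt, ← sub_div]
  push_cast
  ring_nf

/-- The real part of the discrete square root tends to `0` along each row towards the slit. -/
lemma tendsto_discreteSqrt_left {m : ℤ} {n : ℕ} (h : Odd (m + n)) :
    Tendsto (fun j : ℕ => discreteSqrt (m - 2 * j) n) atTop (𝓝 0) := by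
  induction n generalizing m with
  | zero =>
    refine tendsto_const_nhds.congr' ?_
    filter_upwards [eventually_gt_atTop m.toNat] with j hj
    exact (discreteSqrt_of_neg (by grind) (by omega)).symm
  | succ n ih =>
    have h1 := ih (m := m + 1) (by grind)
    have hinj : Function.Injective fun j : ℕ => m - 2 * (j : ℤ) := fun a b hab => by
      have : m - 2 * (a : ℤ) = m - 2 * (b : ℤ) := hab
      omega
    have h2 := (tendsto_discreteSqrt_sub_row n).comp
      (Nat.cofinite_eq_atTop ▸ hinj.tendsto_cofinite)
    have h3 := h1.sub h2
    rw [sub_zero] at h3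
    refine h3.congr fun j => ?_
    simp only [Function.comp]
    rw [show m + 1 - 2 * (j : ℤ) = m - 2 * j + 1 by ring]
    ring

/-- The horizontal difference of the discrete square root, extended to the lower half-plane by
reflection. It turns out to be the harmonic measure of the tip. -/
def tipMeasure (m n : ℤ) : ℝ := discreteSqrt m n.natAbs - discreteSqrt (m - 2) n.natAbs

lemma tipMeasure_eq (m n : ℤ) :
    tipMeasure m n = 2 / sqrtIntegral (3 / 2) 0 * stepIntegral (m + -(1 / 2)) n.natAbs := by
  have h := sqrtIntegral_sub (m + -(1 / 2)) n.natAbs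
  rw [show (m : ℝ) + -(1 / 2) + 1 = m + 1 / 2 by ring,
    show (m : ℝ) + -(1 / 2) - 1 = (m - 2 : ℤ) + 1 / 2 by push_cast; ring] at h
  rw [tipMeasure, discreteSqrt, discreteSqrt, ← sub_div, h]
  ring

lemma tipMeasure_tip : tipMeasure 1 0 = 1 := by
  have h : discreteSqrt (-1) 0 = 0 := discreteSqrt_of_neg (by decide) (by norm_num)
  simp [tipMeasure, discreteSqrt_one_zero, h]

lemma tipMeasure_of_neg {m : ℤ} (hm : Odd m) (h0 : m < 0) : tipMeasure m 0 = 0 := by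
  simp [tipMeasure, discreteSqrt_of_neg hm h0,
    discreteSqrt_of_neg (m := m - 2) (by grind) (by omega)]

lemma tipMeasure_harmonic {m n : ℤ} (h : Odd (m + n)) (h0 : n ≠ 0 ∨ 1 < m) :
    tipMeasure m n = (tipMeasure (m + 1) (n + 1) + tipMeasure (m + 1) (n - 1)
      + tipMeasure (m - 1) (n - 1) + tipMeasure (m - 1) (n + 1)) / 4 := by
  have e1 : m + 1 - 2 = m - 2 + 1 := by ring
  have e2 : m - 1 - 2 = m - 2 - 1 := by ring
  simp only [tipMeasure, e1, e2]
  rcases lt_trichotomy n 0 with hn | rfl | hn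
  · obtain ⟨k, rfl⟩ : ∃ k : ℕ, n = -(k + 1) := ⟨(-n - 1).toNat, by omega⟩
    have a1 : (-((k : ℤ) + 1)).natAbs = k + 1 := by omega
    have a2 : (-((k : ℤ) + 1) + 1).natAbs = k := by omega
    have a3 : (-((k : ℤ) + 1) - 1).natAbs = k + 2 := by omega
    rw [a1, a2, a3]
    linarith [discreteSqrt_harmonic m k, discreteSqrt_harmonic (m - 2) k]
  · have hm : Odd m := by simpa using h
    have h1 := discreteSqrt_harmonic_axis hm (by omega)
    have h2 := discreteSqrt_harmonic_axis (m := m - 2) (by grind) (by grind)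
    simp only [Int.natAbs_zero, zero_add, zero_sub, Int.natAbs_neg, Int.natAbs_one]
    linarith
  · obtain ⟨k, rfl⟩ : ∃ k : ℕ, n = k + 1 := ⟨(n - 1).toNat, by omega⟩
    have a1 : ((k : ℤ) + 1).natAbs = k + 1 := by omega
    have a2 : ((k : ℤ) + 1 + 1).natAbs = k + 2 := by omega
    have a3 : ((k : ℤ) + 1 - 1).natAbs = k := by omega
    rw [a1, a2, a3]
    linarith [discreteSqrt_harmonic m k, discreteSqrt_harmonic (m - 2) k]

lemma finite_le_abs_tipMeasure {ε : ℝ} (hε : 0 < ε) :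
    {p : ℤ × ℤ | ε ≤ |tipMeasure p.1 p.2|}.Finite := by
  have hc : 0 < 2 / sqrtIntegral (3 / 2) 0 := div_pos two_pos sqrtIntegral_tip_pos
  set c := 2 / sqrtIntegral (3 / 2) 0
  obtain ⟨N, hN⟩ := exists_abs_stepIntegral_lt (ε := ε / c) (by positivity)
  have habs : ∀ m n : ℤ, ε ≤ |tipMeasure m n| → ε / c ≤ |stepIntegral (m + -(1 / 2)) n.natAbs| := by
    intro m n h
    rw [tipMeasure_eq, abs_mul, abs_of_pos hc] at h
    rwa [div_le_iff₀' hc]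
  have hrow : ∀ n : ℕ, {m : ℤ | ε / c ≤ |stepIntegral (m + -(1 / 2)) n|}.Finite := by
    intro n
    have h := (tendsto_stepIntegral_row (-(1 / 2)) n).abs
    rw [abs_zero] at h
    have := h.eventually (gt_mem_nhds (show 0 < ε / c by positivity))
    rw [Filter.eventually_cofinite] at this
    simpa only [not_lt] using this
  refine (Set.Finite.biUnion (Set.finite_Icc (-(N : ℤ)) N) fun n _ =>
    (hrow n.natAbs).image fun m => (m, n)).subset ?_
  rintro ⟨m, n⟩ hmn
  have h := habs m n hmn
  simp only [mem_iUnion, mem_image, mem_Icc]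
  refine ⟨n, ?_, m, h, rfl⟩
  by_contra hn
  exact absurd (hN n.natAbs (by omega) (m + -(1 / 2))) (not_lt.2 h)

/-- Telescoping: the discrete square root is the sum of its horizontal differences. The
differences are required to be nonnegative, which holds for a harmonic measure. -/
lemma hasSum_tipMeasure {m n : ℤ} (h : Odd (m + n)) (h0 : ∀ j : ℕ, 0 ≤ tipMeasure (m - 2 * j) n) :
    HasSum (fun j : ℕ => tipMeasure (m - 2 * j) n) (discreteSqrt m n.natAbs) := by
  rw [hasSum_iff_tendsto_nat_of_nonneg h0]
  have hs : ∀ N : ℕ, ∑ j ∈ Finset.range N, tipMeasure (m - 2 * j) n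
      = discreteSqrt m n.natAbs - discreteSqrt (m - 2 * N) n.natAbs := by
    intro N
    induction N with
    | zero => simp
    | succ N ih =>
      rw [Finset.sum_range_succ, ih, tipMeasure]
      push_cast
      rw [show m - 2 * ((N : ℤ) + 1) = m - 2 * N - 2 by ring]
      ring
  simp only [hs]
  have := (tendsto_discreteSqrt_left (m := m) (n := n.natAbs) (by grind)).const_sub
    (discreteSqrt m n.natAbs)
  rwa [sub_zero] at this

/-! ### Harmonic measures as solutions of the discrete Dirichlet problem -/

/-- The lattice point with coordinates `m + 1/2` and `n`, in units of `δ` and relative to `a`. It is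
a corner of type `1` if `m + n` is odd, and of type `i` if `m + n` is even. -/
def latticePt (δ : ℝ) (a : ℂ) (m n : ℤ) : ℂ := a + δ * (m + 1 / 2 + n * I)

lemma latticePt_inj {δ : ℝ} {a : ℂ} (hδ : δ ≠ 0) {m n m' n' : ℤ} :
    latticePt δ a m n = latticePt δ a m' n' ↔ m = m' ∧ n = n' := by
  refine ⟨fun h => ?_, fun h => by rw [h.1, h.2]⟩
  have h1 : (m + 1 / 2 + n * I : ℂ) = m' + 1 / 2 + n' * I :=
    mul_left_cancel₀ (ofReal_ne_zero.2 hδ) (add_left_cancel h)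
  have hre := congrArg re h1
  have him := congrArg im h1
  simp at hre him
  exact ⟨by exact_mod_cast hre, by exact_mod_cast him⟩

/-- The maximum principle on a sublattice `P` stable under the diagonal steps. -/
lemma nonpos_of_subharmonic {P : ℤ → ℤ → Prop} {D : ℤ → ℤ → ℝ}
    (hP : ∀ m n, P m n →
      P (m + 1) (n + 1) ∧ P (m + 1) (n - 1) ∧ P (m - 1) (n - 1) ∧ P (m - 1) (n + 1))
    (hD : ∀ m n, P m n → D m n ≤ 0 ∨ D m n =
      (D (m + 1) (n + 1) + D (m + 1) (n - 1) + D (m - 1) (n - 1) + D (m - 1) (n + 1)) / 4)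
    (hfin : ∀ ε > 0, {p : ℤ × ℤ | P p.1 p.2 ∧ ε ≤ D p.1 p.2}.Finite)
    {m n : ℤ} (hmn : P m n) : D m n ≤ 0 := by
  by_contra! hpos
  set S := {p : ℤ × ℤ | P p.1 p.2 ∧ D m n ≤ D p.1 p.2}
  obtain ⟨p, hp, hmax⟩ := (hfin _ hpos).exists_maximalFor (fun p => D p.1 p.2) S
    ⟨(m, n), hmn, le_rfl⟩
  have hle : ∀ q : ℤ × ℤ, P q.1 q.2 → D q.1 q.2 ≤ D p.1 p.2 := by
    intro q hq
    by_contra! hlt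
    exact absurd (hmax (j := q) ⟨hq, hp.2.trans hlt.le⟩ hlt.le) (not_le.2 hlt)
  -- Among the points where the maximum is attained, one is rightmost.
  have hfin2 : {q : ℤ × ℤ | P q.1 q.2 ∧ D p.1 p.2 ≤ D q.1 q.2}.Finite :=
    hfin _ (hpos.trans_le hp.2)
  obtain ⟨q, hq, hqmax⟩ := hfin2.exists_maximalFor (fun q => q.1) _ ⟨p, hp.1, le_rfl⟩
  obtain ⟨h1, h2, h3, h4⟩ := hP _ _ hq.1
  have hqpos : 0 < D q.1 q.2 := hpos.trans_le (hp.2.trans hq.2)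
  have heq := (hD _ _ hq.1).resolve_left (not_le.2 hqpos)
  have l1 := hle (q.1 + 1, q.2 + 1) h1
  have l2 := hle (q.1 + 1, q.2 - 1) h2
  have l3 := hle (q.1 - 1, q.2 - 1) h3
  have l4 := hle (q.1 - 1, q.2 + 1) h4
  have hq2 := hq.2
  have : D p.1 p.2 ≤ D (q.1 + 1) (q.2 + 1) := by
    simp only at l1 l2 l3 l4
    linarith
  have := hqmax (j := (q.1 + 1, q.2 + 1)) ⟨h1, this⟩ (by simp)
  simp at this

lemma hitProb_nonneg (δ : ℝ) (b : ℂ) (S : Set ℂ) (k : ℕ) (z : ℂ) : 0 ≤ hitProb δ b S k z := by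
  induction k generalizing z with
  | zero => rw [hitProb]; split_ifs <;> norm_num
  | succ k ih =>
    rw [hitProb]
    split_ifs
    · exact zero_le_one
    · exact le_rfl
    · have := ih (z + δ * (1 + I))
      have := ih (z + δ * (1 - I))
      have := ih (z - δ * (1 + I))
      have := ih (z - δ * (1 - I))
      positivity

lemma hitProb_le_one (δ : ℝ) (b : ℂ) (S : Set ℂ) (k : ℕ) (z : ℂ) : hitProb δ b S k z ≤ 1 := by
  induction k generalizing z with
  | zero => rw [hitProb]; split_ifs <;> norm_num
  | succ k ih =>
    rw [hitProb]
    split_ifs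
    · exact le_rfl
    · exact zero_le_one
    · linarith [ih (z + δ * (1 + I)), ih (z + δ * (1 - I)), ih (z - δ * (1 + I)),
        ih (z - δ * (1 - I))]

lemma monotone_hitProb (δ : ℝ) (b : ℂ) (S : Set ℂ) (z : ℂ) :
    Monotone fun k => hitProb δ b S k z := by
  refine monotone_nat_of_le_succ fun k => ?_
  induction k generalizing z with
  | zero =>
    rw [hitProb]
    split_ifs with h
    · rw [hitProb, if_pos h]
    · exact hitProb_nonneg _ _ _ _ _
  | succ k ih =>
    rw [hitProb, hitProb]
    split_ifs
    · exact le_rfl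
    · exact le_rfl
    · linarith [ih (z + δ * (1 + I)), ih (z + δ * (1 - I)), ih (z - δ * (1 + I)),
        ih (z - δ * (1 - I))]

lemma tendsto_hitProb (δ : ℝ) (b : ℂ) (S : Set ℂ) (z : ℂ) :
    Tendsto (fun k => hitProb δ b S k z) atTop (𝓝 (harmonicMeasure δ b S z)) :=
  tendsto_atTop_ciSup (monotone_hitProb δ b S z)
    ⟨1, by rintro _ ⟨k, rfl⟩; exact hitProb_le_one δ b S k z⟩

lemma harmonicMeasure_nonneg (δ : ℝ) (b : ℂ) (S : Set ℂ) (z : ℂ) :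
    0 ≤ harmonicMeasure δ b S z :=
  ge_of_tendsto' (tendsto_hitProb δ b S z) fun k => hitProb_nonneg δ b S k z

lemma harmonicMeasure_self (δ : ℝ) (b : ℂ) (S : Set ℂ) : harmonicMeasure δ b S b = 1 := by
  refine tendsto_nhds_unique (tendsto_hitProb δ b S b) (tendsto_const_nhds.congr fun k => ?_)
  cases k <;> simp [hitProb]

lemma harmonicMeasure_of_mem (δ : ℝ) {b z : ℂ} {S : Set ℂ} (hb : z ≠ b) (hS : z ∈ S) :
    harmonicMeasure δ b S z = 0 := by
  refine tendsto_nhds_unique (tendsto_hitProb δ b S z) (tendsto_const_nhds.congr fun k => ?_)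
  cases k <;> simp [hitProb, hb, hS]

lemma harmonicMeasure_step (δ : ℝ) {b z : ℂ} {S : Set ℂ} (hb : z ≠ b) (hS : z ∉ S) :
    harmonicMeasure δ b S z = (harmonicMeasure δ b S (z + δ * (1 + I))
      + harmonicMeasure δ b S (z + δ * (1 - I)) + harmonicMeasure δ b S (z - δ * (1 + I))
      + harmonicMeasure δ b S (z - δ * (1 - I))) / 4 := by
  have h := tendsto_hitProb δ b S
  refine tendsto_nhds_unique ((h z).comp (tendsto_add_atTop_nat 1))
    ((((((h _).add (h _)).add (h _)).add (h _)).div_const 4).congr fun k => ?_)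
  simp [hitProb, hb, hS]

/-- A solution of the Dirichlet problem that tends to `0` at infinity is the harmonic measure. -/
lemma harmonicMeasure_eq {δ : ℝ} {a b : ℂ} {S : Set ℂ} {P : ℤ → ℤ → Prop} {h : ℤ → ℤ → ℝ}
    (hP : ∀ m n, P m n →
      P (m + 1) (n + 1) ∧ P (m + 1) (n - 1) ∧ P (m - 1) (n - 1) ∧ P (m - 1) (n + 1))
    (hb : ∀ m n, P m n → latticePt δ a m n = b → h m n = 1)
    (hS : ∀ m n, P m n → latticePt δ a m n ≠ b → latticePt δ a m n ∈ S → h m n = 0)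
    (hh : ∀ m n, P m n → latticePt δ a m n ≠ b → latticePt δ a m n ∉ S → h m n =
      (h (m + 1) (n + 1) + h (m + 1) (n - 1) + h (m - 1) (n - 1) + h (m - 1) (n + 1)) / 4)
    (hfin : ∀ ε > 0, {p : ℤ × ℤ | P p.1 p.2 ∧ ε ≤ |h p.1 p.2|}.Finite)
    {m n : ℤ} (hmn : P m n) : harmonicMeasure δ b S (latticePt δ a m n) = h m n := by
  have s1 : ∀ m n : ℤ, latticePt δ a m n + δ * (1 + I) = latticePt δ a (m + 1) (n + 1) := by
    intro m n; simp only [latticePt]; push_cast; ring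
  have s2 : ∀ m n : ℤ, latticePt δ a m n + δ * (1 - I) = latticePt δ a (m + 1) (n - 1) := by
    intro m n; simp only [latticePt]; push_cast; ring
  have s3 : ∀ m n : ℤ, latticePt δ a m n - δ * (1 + I) = latticePt δ a (m - 1) (n - 1) := by
    intro m n; simp only [latticePt]; push_cast; ring
  have s4 : ∀ m n : ℤ, latticePt δ a m n - δ * (1 - I) = latticePt δ a (m - 1) (n + 1) := by
    intro m n; simp only [latticePt]; push_cast; ring
  have hnonneg : ∀ m n, P m n → 0 ≤ h m n := by
    intro m n hmn
    refine neg_nonpos.1 (nonpos_of_subharmonic (P := P) (D := fun m n => -h m n) hP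
      (fun m n hmn => ?_) (fun ε hε => (hfin ε hε).subset fun p hp =>
        ⟨hp.1, hp.2.trans (neg_le_abs _)⟩) hmn)
    by_cases h1 : latticePt δ a m n = b
    · left; rw [hb m n hmn h1]; norm_num
    by_cases h2 : latticePt δ a m n ∈ S
    · left; rw [hS m n hmn h1 h2, neg_zero]
    · right; rw [hh m n hmn h1 h2]; ring
  have hle : ∀ k m n, P m n → hitProb δ b S k (latticePt δ a m n) ≤ h m n := by
    intro k
    induction k with
    | zero =>
      intro m n hmn
      rw [hitProb]
      split_ifs with h1
      · rw [hb m n hmn h1]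
      · exact hnonneg m n hmn
    | succ k ih =>
      intro m n hmn
      rw [hitProb]
      split_ifs with h1 h2
      · rw [hb m n hmn h1]
      · rw [hS m n hmn h1 h2]
      · obtain ⟨p1, p2, p3, p4⟩ := hP m n hmn
        rw [hh m n hmn h1 h2, s1, s2, s3, s4]
        linarith [ih _ _ p1, ih _ _ p2, ih _ _ p3, ih _ _ p4]
  refine le_antisymm (le_of_tendsto' (tendsto_hitProb _ _ _ _) fun k => hle k m n hmn) ?_
  refine sub_nonpos.1 (nonpos_of_subharmonic (P := P)
    (D := fun m n => h m n - harmonicMeasure δ b S (latticePt δ a m n)) hP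
    (fun m n hmn => ?_) (fun ε hε => (hfin ε hε).subset fun p hp => ⟨hp.1, ?_⟩) hmn)
  · by_cases h1 : latticePt δ a m n = b
    · left; rw [hb m n hmn h1, h1, harmonicMeasure_self, sub_self]
    by_cases h2 : latticePt δ a m n ∈ S
    · left; rw [hS m n hmn h1 h2, harmonicMeasure_of_mem δ h1 h2, sub_self]
    · right
      rw [hh m n hmn h1 h2, harmonicMeasure_step δ h1 h2, s1, s2, s3, s4]
      ring
  · have := harmonicMeasure_nonneg δ b S (latticePt δ a p.1 p.2)
    exact hp.2.trans ((sub_le_self _ this).trans (le_abs_self _))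

lemma latticePt_mem_leftSlit {δ : ℝ} {a : ℂ} (hδ : 0 < δ) {m n : ℤ} :
    latticePt δ a m n ∈ leftSlit a ↔ n = 0 ∧ m < 0 := by
  constructor
  · rintro ⟨t, ht, h⟩
    have h1 : (δ * (m + 1 / 2 + n * I) : ℂ) = -t := by
      rw [latticePt, sub_eq_add_neg] at h; exact add_left_cancel h
    have hre := congrArg re h1
    have him := congrArg im h1
    simp at hre him
    have hn : n = 0 := him.resolve_left hδ.ne'
    refine ⟨hn, ?_⟩
    by_contra! hm
    have : (0 : ℝ) ≤ m := by exact_mod_cast hm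
    have := mul_pos hδ (show (0 : ℝ) < m + 2⁻¹ by positivity)
    linarith
  · rintro ⟨rfl, hm⟩
    have : (m : ℝ) ≤ -1 := by exact_mod_cast (show m ≤ -1 by omega)
    refine ⟨-(δ * (m + 1 / 2)), ?_, ?_⟩
    · nlinarith
    · simp [latticePt]

lemma latticePt_mem_rightSlit {δ : ℝ} {a : ℂ} (hδ : 0 < δ) {m n : ℤ} :
    latticePt δ a m n ∈ rightSlit a ↔ n = 0 ∧ 0 ≤ m := by
  constructor
  · rintro ⟨t, ht, h⟩
    have h1 : (δ * (m + 1 / 2 + n * I) : ℂ) = t := add_left_cancel h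
    have hre := congrArg re h1
    have him := congrArg im h1
    simp at hre him
    have hn : n = 0 := him.resolve_left hδ.ne'
    refine ⟨hn, ?_⟩
    by_contra! hm
    have : (m : ℝ) ≤ -1 := by exact_mod_cast (show m ≤ -1 by omega)
    have := mul_pos hδ (show (0 : ℝ) < -(m + 2⁻¹) by linarith)
    linarith
  · rintro ⟨rfl, hm⟩
    have : (0 : ℝ) ≤ m := by exact_mod_cast hm
    refine ⟨δ * (m + 1 / 2), by positivity, ?_⟩
    simp [latticePt]

lemma HX_latticePt {δ : ℝ} (hδ : 0 < δ) (a : ℂ) {m n : ℤ} (h : Odd (m + n)) :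
    HX δ a (latticePt δ a m n) = tipMeasure m n := by
  have htip : a + 3 * δ / 2 = latticePt δ a 1 0 := by simp only [latticePt]; push_cast; ring
  rw [HX, htip]
  congr 1
  refine harmonicMeasure_eq (P := fun m n => Odd (m + n)) (h := tipMeasure) (fun m n h => by grind)
    ?_ ?_ ?_ ?_ h
  · intro m n _ h1
    obtain ⟨rfl, rfl⟩ := (latticePt_inj hδ.ne').1 h1
    exact tipMeasure_tip
  · intro m n hmn _ h2
    obtain ⟨rfl, hm⟩ := (latticePt_mem_leftSlit hδ).1 h2
    exact tipMeasure_of_neg (by simpa using hmn) hm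
  · intro m n hmn h1 h2
    rw [latticePt_mem_leftSlit hδ] at h2
    rw [Ne, latticePt_inj hδ.ne'] at h1
    exact tipMeasure_harmonic hmn (by grind)
  · exact fun ε hε => (finite_le_abs_tipMeasure hε).subset fun p hp => hp.2

lemma HY_latticePt {δ : ℝ} (hδ : 0 < δ) (a : ℂ) {m n : ℤ} (h : Even (m + n)) :
    HY δ a (latticePt δ a m n) = -I * tipMeasure (1 - m) n := by
  have htip : a + δ / 2 = latticePt δ a 0 0 := by simp only [latticePt]; push_cast; ring
  rw [HY, htip]
  congr 2
  refine harmonicMeasure_eq (P := fun m n => Even (m + n)) (h := fun m n => tipMeasure (1 - m) n)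
    (fun m n h => by grind) ?_ ?_ ?_ ?_ h
  · intro m n _ h1
    obtain ⟨rfl, rfl⟩ := (latticePt_inj hδ.ne').1 h1
    simpa using tipMeasure_tip
  · intro m n hmn h1 h2
    obtain ⟨rfl, hm⟩ := (latticePt_mem_rightSlit hδ).1 h2
    rw [Ne, latticePt_inj hδ.ne'] at h1
    exact tipMeasure_of_neg (by grind) (by grind)
  · intro m n hmn h1 h2
    rw [latticePt_mem_rightSlit hδ] at h2
    have := tipMeasure_harmonic (m := 1 - m) (n := n) (by grind) (by grind)
    rw [this, show 1 - (m + 1) = 1 - m - 1 by ring, show 1 - (m - 1) = 1 - m + 1 by ring]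
    ring
  · intro ε hε
    refine ((finite_le_abs_tipMeasure hε).preimage
      (f := fun p : ℤ × ℤ => (1 - p.1, p.2)) ?_).subset fun p hp => hp.2
    rintro ⟨m, n⟩ _ ⟨m', n'⟩ _ h
    simp at h ⊢
    omega

lemma tipMeasure_nonneg {m n : ℤ} (h : Odd (m + n)) : 0 ≤ tipMeasure m n := by
  have h1 := HX_latticePt one_pos 0 h
  rw [HX, ofReal_inj] at h1
  rw [← h1]
  exact harmonicMeasure_nonneg _ _ _ _

/-! ### Coordinates of corners and medial vertices -/

lemma exists_latticePt_of_mem_one {δ : ℝ} {a z : ℂ} (h : z ∈ cornerSet δ a .one) :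
    ∃ m n : ℤ, Odd (m + n) ∧ z = latticePt δ a m n := by
  obtain ⟨v, ⟨k, l, rfl⟩, rfl⟩ := h
  refine ⟨k - l + 1, k + l, ⟨k, by ring⟩, ?_⟩
  simp only [latticePt, CornerType.dir]
  push_cast
  linear_combination (δ * l : ℂ) * I_mul_I

lemma exists_latticePt_of_mem_i {δ : ℝ} {a z : ℂ} (h : z ∈ cornerSet δ a .i) :
    ∃ m n : ℤ, Even (m + n) ∧ z = latticePt δ a m n := by
  obtain ⟨v, ⟨k, l, rfl⟩, rfl⟩ := h
  refine ⟨k - l, k + l, ⟨k, by ring⟩, ?_⟩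
  simp only [latticePt, CornerType.dir]
  push_cast
  linear_combination (δ * l : ℂ) * I_mul_I

/-- The point with coordinates `m` and `n + 1/2`, in units of `δ` and relative to `a`: a corner of
type `λ` if `m + n` is odd, and of type `conj λ` if `m + n` is even. -/
def crossPt (δ : ℝ) (a : ℂ) (m n : ℤ) : ℂ := a + δ * (m + (n + 1 / 2) * I)

lemma exists_crossPt_of_mem_lam {δ : ℝ} {a z : ℂ} (h : z ∈ cornerSet δ a .lam) :
    ∃ m n : ℤ, Odd (m + n) ∧ z = crossPt δ a m n := by
  obtain ⟨v, ⟨k, l, rfl⟩, rfl⟩ := h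
  refine ⟨k - l + 1, k + l, ⟨k, by ring⟩, ?_⟩
  simp only [crossPt, CornerType.dir]
  push_cast
  linear_combination (δ * l : ℂ) * I_mul_I

lemma exists_crossPt_of_mem_lamBar {δ : ℝ} {a z : ℂ} (h : z ∈ cornerSet δ a .lamBar) :
    ∃ m n : ℤ, Even (m + n) ∧ z = crossPt δ a m n := by
  obtain ⟨v, ⟨k, l, rfl⟩, rfl⟩ := h
  refine ⟨k - l + 1, k + l - 1, ⟨k, by ring⟩, ?_⟩
  simp only [crossPt, CornerType.dir]
  push_cast
  linear_combination (δ * l : ℂ) * I_mul_I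

/-- The medial vertex with coordinates `m + 1/2` and `n + 1/2`, in units of `δ` and relative to
`a`. -/
def medialPt (δ : ℝ) (a : ℂ) (m n : ℤ) : ℂ := a + δ * (m + 1 / 2 + (n + 1 / 2) * I)

lemma exists_medialPt_of_mem {δ : ℝ} {a z : ℂ} (hδ : 0 < δ) (h : z ∈ medialSet δ a) :
    ∃ m n : ℤ, z = medialPt δ a m n := by
  obtain ⟨_, ⟨k, l, rfl⟩, _, ⟨k', l', rfl⟩, hd, rfl⟩ := h
  have h1 : (k - k') ^ 2 + (l - l') ^ 2 = 1 := by
    rw [dist_eq, show a + δ + δ * ((1 + I) * (k + l * I)) - (a + δ + δ * ((1 + I) * (k' + l' * I)))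
      = (δ : ℂ) * ((1 + I) * (((k - k' : ℤ) : ℝ) + ((l - l' : ℤ) : ℝ) * I)) by push_cast; ring] at hd
    have h2 := congrArg (· ^ 2) hd
    simp only [← normSq_eq_norm_sq, normSq_mul, normSq_ofReal, normSq_add_mul_I, mul_pow,
      Real.sq_sqrt zero_le_two] at h2
    rw [show (1 + I : ℂ) = (1 : ℝ) + (1 : ℝ) * I by simp, normSq_add_mul_I] at h2
    have h3 : ((k - k' : ℤ) : ℝ) ^ 2 + ((l - l' : ℤ) : ℝ) ^ 2 = 1 := by
      have : (2 * δ ^ 2) ≠ 0 := by positivity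
      apply mul_left_cancel₀ this
      linarith
    exact_mod_cast h3
  have hodd : Odd (k + k' + l + l') := by
    have h2 : ¬ Even ((k - k') ^ 2 + (l - l') ^ 2) := by rw [h1]; decide
    rw [Int.even_add, Int.even_pow' two_ne_zero, Int.even_pow' two_ne_zero, ← Int.even_add,
      Int.not_even_iff_odd] at h2
    obtain ⟨r, hr⟩ := h2
    exact ⟨r + k' + l', by omega⟩
  obtain ⟨n, hn⟩ := hodd
  refine ⟨n - l - l' + 1, n, ?_⟩
  have hn' : (k + k' + l + l' : ℂ) = 2 * n + 1 := by exact_mod_cast hn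
  simp only [medialPt]
  push_cast
  linear_combination (δ / 2 * (1 + I) : ℂ) * hn' + (δ * (l + l') / 2 : ℂ) * I_mul_I

lemma four_mul_sq_add_sq_of_dist {δ : ℝ} {a : ℂ} (hδ : 0 < δ) {x y x' y' : ℝ}
    (h : dist (a + δ * (x + y * I)) (a + δ * (x' + y' * I)) = δ / 2) :
    (2 * (x - x')) ^ 2 + (2 * (y - y')) ^ 2 = 1 := by
  rw [dist_eq, show a + δ * (x + y * I) - (a + δ * (x' + y' * I))
    = (δ : ℂ) * (((x - x' : ℝ) : ℂ) + ((y - y' : ℝ) : ℂ) * I) by push_cast; ring] at h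
  have h2 := congrArg (· ^ 2) h
  simp only [← normSq_eq_norm_sq, normSq_mul, normSq_ofReal, normSq_add_mul_I] at h2
  have : δ ^ 2 ≠ 0 := by positivity
  apply mul_left_cancel₀ this
  linarith

lemma eq_of_four_mul_sq_add_sq {i j : ℤ} (h : (2 * i) ^ 2 + (2 * j - 1) ^ 2 = 1) :
    i = 0 ∧ (j = 0 ∨ j = 1) := by
  have hi : i = 0 := by
    by_contra hi
    have : 0 < i ^ 2 := by positivity
    nlinarith [sq_nonneg (2 * j - 1)]
  subst hi
  have : j * (j - 1) = 0 := by nlinarith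
  rcases mul_eq_zero.1 this with h | h <;> omega

lemma eq_of_dist_latticePt_medialPt {δ : ℝ} {a : ℂ} (hδ : 0 < δ) {m n m' n' : ℤ}
    (h : dist (latticePt δ a m n) (medialPt δ a m' n') = δ / 2) :
    m' = m ∧ (n' = n ∨ n' = n - 1) := by
  have := four_mul_sq_add_sq_of_dist (x := m + 1 / 2) (y := n) (x' := m' + 1 / 2) (y' := n' + 1 / 2)
    (a := a) hδ (by simpa [latticePt, medialPt] using h)
  have h2 : (2 * ((m - m' : ℤ) : ℝ)) ^ 2 + (2 * ((n - n' : ℤ) : ℝ) - 1) ^ 2 = 1 := by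
    push_cast; linear_combination this
  have := eq_of_four_mul_sq_add_sq (i := m - m') (j := n - n') (by exact_mod_cast h2)
  omega

lemma eq_of_dist_crossPt_medialPt {δ : ℝ} {a : ℂ} (hδ : 0 < δ) {m n m' n' : ℤ}
    (h : dist (crossPt δ a m n) (medialPt δ a m' n') = δ / 2) :
    n' = n ∧ (m' = m ∨ m' = m - 1) := by
  have := four_mul_sq_add_sq_of_dist (x := m) (y := n + 1 / 2) (x' := m' + 1 / 2) (y' := n' + 1 / 2)
    (a := a) hδ (by simpa [crossPt, medialPt] using h)
  have h2 : (2 * ((n - n' : ℤ) : ℝ)) ^ 2 + (2 * ((m - m' : ℤ) : ℝ) - 1) ^ 2 = 1 := by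
    push_cast; linear_combination this
  have := eq_of_four_mul_sq_add_sq (i := n - n') (j := m - m') (by exact_mod_cast h2)
  omega

lemma im_latticePt_sub (δ : ℝ) (a : ℂ) (m n : ℤ) : (latticePt δ a m n - a).im = δ * n := by
  simp [latticePt]

lemma re_latticePt_sub (δ : ℝ) (a : ℂ) (m n : ℤ) : (latticePt δ a m n - a).re = δ * (m + 1 / 2) := by
  simp [latticePt]

lemma im_crossPt_sub (δ : ℝ) (a : ℂ) (m n : ℤ) : (crossPt δ a m n - a).im = δ * (n + 1 / 2) := by
  simp [crossPt]

lemma im_medialPt_sub (δ : ℝ) (a : ℂ) (m n : ℤ) : (medialPt δ a m n - a).im = δ * (n + 1 / 2) := by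
  simp [medialPt]

lemma int_add_half_pos_iff {n : ℤ} : (0 : ℝ) < n + 1 / 2 ↔ 0 ≤ n := by
  constructor
  · intro h
    by_contra! hn
    have : (n : ℝ) ≤ -1 := by exact_mod_cast (show n ≤ -1 by omega)
    linarith
  · intro h
    have : (0 : ℝ) ≤ n := by exact_mod_cast h
    linarith

lemma int_add_half_ne_zero (n : ℤ) : (n + 1 / 2 : ℝ) ≠ 0 := by
  intro h
  have h2 : (2 * n + 1 : ℝ) = 0 := by linarith
  have h3 : 2 * n + 1 = 0 := by exact_mod_cast h2
  omega

/-! ### Sheets of the double cover -/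

namespace DoubleCover

variable {a : ℂ}

lemma root_sq (p : DoubleCover a) : p.root ^ 2 = p.pt - a := p.2.2

lemma re_pt_sub (p : DoubleCover a) : (p.pt - a).re = p.root.re ^ 2 - p.root.im ^ 2 := by
  rw [← root_sq, sq, mul_re]; ring

lemma im_pt_sub (p : DoubleCover a) : (p.pt - a).im = 2 * (p.root.re * p.root.im) := by
  rw [← root_sq, sq, mul_im]; ring

/-- Within a closed half-plane bounded by the real axis, adjacent points lie in the same quadrant of
the `√(z - a)`-plane. -/
lemma sign_root_eq {p q : DoubleCover a} (h : 0 < (q.root / p.root).re)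
    (hq : (q.pt - a).im ≠ 0) (hpq : 0 ≤ (p.pt - a).im * (q.pt - a).im) :
    (Real.sign p.root.re = 0 ∨ Real.sign q.root.re = Real.sign p.root.re) ∧
    (Real.sign p.root.im = 0 ∨ Real.sign q.root.im = Real.sign p.root.im) := by
  rw [im_pt_sub] at hq
  rw [im_pt_sub, im_pt_sub] at hpq
  have h0 : p.root ≠ 0 := by rintro h0; simp [h0] at h
  have h1 : 0 < p.root.re * q.root.re + p.root.im * q.root.im := by
    rw [div_re, ← add_div] at h
    have := (div_pos_iff_of_pos_right (normSq_pos.2 h0)).1 h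
    linarith
  have hqr : q.root.re ≠ 0 := fun h => hq (by rw [h]; ring)
  have hqi : q.root.im ≠ 0 := fun h => hq (by rw [h]; ring)
  have h2 : 0 ≤ (p.root.re * q.root.re) * (p.root.im * q.root.im) := by nlinarith
  have h3 : 0 ≤ p.root.re * q.root.re := by
    by_contra! hneg
    nlinarith
  have h4 : 0 ≤ p.root.im * q.root.im := by
    by_contra! hneg
    nlinarith
  have key : ∀ x y : ℝ, y ≠ 0 → 0 ≤ x * y → Real.sign x = 0 ∨ Real.sign y = Real.sign x := by
    intro x y hy hxy
    rcases lt_trichotomy x 0 with hx | rfl | hx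
    · right
      have : y < 0 := lt_of_le_of_ne (by nlinarith) hy
      rw [Real.sign_of_neg hx, Real.sign_of_neg this]
    · left; exact Real.sign_zero
    · right
      have : 0 < y := lt_of_le_of_ne (by nlinarith) hy.symm
      rw [Real.sign_of_pos hx, Real.sign_of_pos this]
  exact ⟨key _ _ hqr h3, key _ _ hqi h4⟩

lemma sign_re_eq_sign_im {p : DoubleCover a} (h : 0 < (p.pt - a).im) :
    Real.sign p.root.re = Real.sign p.root.im := by
  rw [im_pt_sub] at h
  rcases pos_and_pos_or_neg_and_neg_of_mul_pos (a := p.root.re) (b := p.root.im) (by linarith)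
    with ⟨h1, h2⟩ | ⟨h1, h2⟩
  · rw [Real.sign_of_pos h1, Real.sign_of_pos h2]
  · rw [Real.sign_of_neg h1, Real.sign_of_neg h2]

lemma sign_re_eq_neg_sign_im {p : DoubleCover a} (h : (p.pt - a).im < 0) :
    Real.sign p.root.re = -Real.sign p.root.im := by
  rw [im_pt_sub] at h
  rcases mul_neg_iff.1 (show p.root.re * p.root.im < 0 by linarith) with ⟨h1, h2⟩ | ⟨h1, h2⟩
  · rw [Real.sign_of_pos h1, Real.sign_of_neg h2, neg_neg]
  · rw [Real.sign_of_neg h1, Real.sign_of_pos h2]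

lemma slit_of_sign_re {p : DoubleCover a} {δ : ℝ} (hδ : 0 < δ) {m n : ℤ}
    (hp : p.pt = latticePt δ a m n) (h : Real.sign p.root.re = 0) : n = 0 ∧ m < 0 := by
  rw [Real.sign_eq_zero_iff] at h
  have h1 := im_pt_sub p
  have h2 := re_pt_sub p
  rw [hp, im_latticePt_sub, h] at h1
  rw [hp, re_latticePt_sub, h] at h2
  constructor
  · have : (n : ℝ) = 0 := (mul_eq_zero.1 (by linarith : δ * n = 0)).resolve_left hδ.ne'
    exact_mod_cast this
  · by_contra! hm
    have := mul_pos hδ (int_add_half_pos_iff.2 hm)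
    nlinarith

lemma slit_of_sign_im {p : DoubleCover a} {δ : ℝ} (hδ : 0 < δ) {m n : ℤ}
    (hp : p.pt = latticePt δ a m n) (h : Real.sign p.root.im = 0) : n = 0 ∧ 0 ≤ m := by
  rw [Real.sign_eq_zero_iff] at h
  have h1 := im_pt_sub p
  have h2 := re_pt_sub p
  rw [hp, im_latticePt_sub, h] at h1
  rw [hp, re_latticePt_sub, h] at h2
  constructor
  · have : (n : ℝ) = 0 := (mul_eq_zero.1 (by linarith : δ * n = 0)).resolve_left hδ.ne'
    exact_mod_cast this
  · by_contra! hm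
    have h3 : (m + 1 / 2 : ℝ) ≤ 0 := by
      by_contra! h3
      have := int_add_half_pos_iff.1 h3
      omega
    have h4 : (m + 1 / 2 : ℝ) = 0 := by nlinarith
    exact int_add_half_ne_zero m h4

end DoubleCover

/-! ### s-holomorphic spinors from data in a half-plane -/

/-- The value at a corner of type `1` or `i`, given the real parts `α` at the corners of type `1` and
the imaginary parts `β` at the corners of type `i` of the closed upper half-plane, and the signs `s`
and `t` which `α` and `β` take on the given sheet. -/
def cornerVal (α β : ℤ → ℕ → ℝ) (s t : ℝ) (m n : ℤ) : ℂ :=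
  if Odd (m + n) then ((s * α m n.natAbs : ℝ) : ℂ) else ((t * β m n.natAbs : ℝ) : ℂ) * I

/-- The value at a medial vertex: the sum of the values at the adjacent corners of types `1` and `i`,
which are its real and imaginary parts. -/
def medialVal (α β : ℤ → ℕ → ℝ) (s t : ℝ) (m n : ℤ) : ℂ :=
  cornerVal α β s t m n + cornerVal α β s t m (n + 1)

/-- The value at a corner of type `λ` or `conj λ`: the projection of the value at the adjacent medial
vertex on its right. -/
def crossVal (α β : ℤ → ℕ → ℝ) (s t : ℝ) (m n : ℤ) : ℂ :=
  1 / 2 * (medialVal α β s t m n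
    + (if Odd (m + n) then -I else I) * (starRingEnd ℂ) (medialVal α β s t m n))

/-- The function on the double cover with the above values; `s` and `t` give the signs in terms of
the square root `√(z - a)`. -/
def spinorExt (δ : ℝ) (a : ℂ) (α β : ℤ → ℕ → ℝ) (s t : ℂ → ℝ) (p : DoubleCover a) : ℂ :=
  open Classical in
  δ * (if Int.fract ((p.pt - a) / δ).im = 0 then
      cornerVal α β (s p.root) (t p.root) ⌊((p.pt - a) / δ).re⌋ ⌊((p.pt - a) / δ).im⌋
    else if Int.fract ((p.pt - a) / δ).re = 0 then
      crossVal α β (s p.root) (t p.root) ⌊((p.pt - a) / δ).re⌋ ⌊((p.pt - a) / δ).im⌋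
    else
      medialVal α β (s p.root) (t p.root) ⌊((p.pt - a) / δ).re⌋ ⌊((p.pt - a) / δ).im⌋)

lemma floor_add_half (n : ℤ) : ⌊(n + 1 / 2 : ℝ)⌋ = n := by
  rw [Int.floor_eq_iff]; constructor <;> linarith

lemma fract_add_half (n : ℤ) : Int.fract (n + 1 / 2 : ℝ) ≠ 0 := by
  rw [Int.fract, floor_add_half]; norm_num

section spinorExt

variable {δ : ℝ} {a : ℂ} {α β : ℤ → ℕ → ℝ} {s t : ℂ → ℝ}

lemma spinorExt_of_latticePt (hδ : 0 < δ) {p : DoubleCover a} {m n : ℤ}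
    (hp : p.pt = latticePt δ a m n) :
    spinorExt δ a α β s t p = δ * cornerVal α β (s p.root) (t p.root) m n := by
  have h : (p.pt - a) / δ = ((m + 1 / 2 : ℝ) : ℂ) + ((n : ℝ) : ℂ) * I := by
    have : (δ : ℂ) ≠ 0 := ofReal_ne_zero.2 hδ.ne'
    rw [hp, latticePt, add_sub_cancel_left, mul_div_cancel_left₀ _ this]
    push_cast; ring
  have hre : ((p.pt - a) / δ).re = m + 1 / 2 := by rw [h]; simp
  have him : ((p.pt - a) / δ).im = n := by rw [h]; simp
  rw [spinorExt, hre, him, Int.fract_intCast, if_pos rfl, floor_add_half, Int.floor_intCast]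

lemma spinorExt_of_crossPt (hδ : 0 < δ) {p : DoubleCover a} {m n : ℤ}
    (hp : p.pt = crossPt δ a m n) :
    spinorExt δ a α β s t p = δ * crossVal α β (s p.root) (t p.root) m n := by
  have h : (p.pt - a) / δ = ((m : ℝ) : ℂ) + ((n + 1 / 2 : ℝ) : ℂ) * I := by
    have : (δ : ℂ) ≠ 0 := ofReal_ne_zero.2 hδ.ne'
    rw [hp, crossPt, add_sub_cancel_left, mul_div_cancel_left₀ _ this]
    push_cast; ring
  have hre : ((p.pt - a) / δ).re = m := by rw [h]; simp
  have him : ((p.pt - a) / δ).im = n + 1 / 2 := by rw [h]; simp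
  rw [spinorExt, hre, him, if_neg (fract_add_half n), Int.fract_intCast, if_pos rfl,
    floor_add_half, Int.floor_intCast]

lemma spinorExt_of_medialPt (hδ : 0 < δ) {p : DoubleCover a} {m n : ℤ}
    (hp : p.pt = medialPt δ a m n) :
    spinorExt δ a α β s t p = δ * medialVal α β (s p.root) (t p.root) m n := by
  have h : (p.pt - a) / δ = ((m + 1 / 2 : ℝ) : ℂ) + ((n + 1 / 2 : ℝ) : ℂ) * I := by
    have : (δ : ℂ) ≠ 0 := ofReal_ne_zero.2 hδ.ne'
    rw [hp, medialPt, add_sub_cancel_left, mul_div_cancel_left₀ _ this]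
    push_cast; ring
  have hre : ((p.pt - a) / δ).re = m + 1 / 2 := by rw [h]; simp
  have him : ((p.pt - a) / δ).im = n + 1 / 2 := by rw [h]; simp
  rw [spinorExt, hre, him, if_neg (fract_add_half n), if_neg (fract_add_half m),
    floor_add_half, floor_add_half]

lemma cornerVal_neg (s t : ℝ) (m n : ℤ) :
    cornerVal α β (-s) (-t) m n = -cornerVal α β s t m n := by
  simp only [cornerVal]
  split_ifs <;> push_cast <;> ring

lemma medialVal_neg (s t : ℝ) (m n : ℤ) :
    medialVal α β (-s) (-t) m n = -medialVal α β s t m n := by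
  simp only [medialVal, cornerVal_neg]
  ring

lemma crossVal_neg (s t : ℝ) (m n : ℤ) :
    crossVal α β (-s) (-t) m n = -crossVal α β s t m n := by
  simp only [crossVal, medialVal_neg, map_neg]
  ring

lemma isSpinor_spinorExt (hs : ∀ r, s (-r) = -s r) (ht : ∀ r, t (-r) = -t r) :
    IsSpinor δ a (spinorExt δ a α β s t) := by
  intro p _
  have h1 : p.flip.pt = p.pt := rfl
  have h2 : p.flip.root = -p.root := rfl
  simp only [spinorExt, h1, h2, hs, ht, cornerVal_neg, medialVal_neg, crossVal_neg]
  split_ifs <;> ring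

lemma medialVal_of_odd {m n : ℤ} (h : Odd (m + n)) (s t : ℝ) :
    medialVal α β s t m n
      = ((s * α m n.natAbs : ℝ) : ℂ) + ((t * β m (n + 1).natAbs : ℝ) : ℂ) * I := by
  have h2 : ¬ Odd (m + (n + 1)) := by grind
  simp only [medialVal, cornerVal, if_pos h, if_neg h2]

lemma medialVal_of_even {m n : ℤ} (h : Even (m + n)) (s t : ℝ) :
    medialVal α β s t m n
      = ((s * α m (n + 1).natAbs : ℝ) : ℂ) + ((t * β m n.natAbs : ℝ) : ℂ) * I := by
  have h1 : ¬ Odd (m + n) := by grind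
  have h2 : Odd (m + (n + 1)) := by grind
  simp only [medialVal, cornerVal, if_neg h1, if_pos h2]
  ring

lemma conj_add_mul_I (x y : ℝ) : (starRingEnd ℂ) ((x : ℂ) + y * I) = x - y * I := by
  simp [sub_eq_add_neg]

lemma val_lam_sq : CornerType.lam.val ^ 2 = -I := by
  rw [CornerType.val, ← exp_nat_mul,
    show ((2 : ℕ) : ℂ) * (-(Real.pi / 4) * I) = -(Real.pi / 2 * I) by push_cast; ring,
    Complex.exp_neg, exp_pi_div_two_mul_I, inv_I]

lemma val_lamBar_sq : CornerType.lamBar.val ^ 2 = I := by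
  rw [CornerType.val, ← exp_nat_mul,
    show ((2 : ℕ) : ℂ) * ((Real.pi / 4) * I) = Real.pi / 2 * I by push_cast; ring,
    exp_pi_div_two_mul_I]

/-- Functions `α`, `β` satisfying the discrete Cauchy–Riemann equations in the upper half-plane
extend to an s-holomorphic spinor if each vanishes on the half of the real axis where its sign is not
defined: the equations in the lower half-plane follow by reflection, and those at the corners of
types `1` and `i` hold by construction. -/
lemma isSHolomorphic_spinorExt (hδ : 0 < δ)
    (hst : (s = fun r => Real.sign r.re) ∧ (t = fun r => Real.sign r.im) ∨
      (s = fun r => Real.sign r.im) ∧ (t = fun r => Real.sign r.re))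
    (h1 : ∀ (m : ℤ) (n : ℕ), α (m + 1) n - α m (n + 1) = β (m + 1) (n + 1) - β m n)
    (h2 : ∀ (m : ℤ) (n : ℕ), α (m + 1) (n + 1) - α m n = β m (n + 1) - β (m + 1) n)
    (hα : ∀ (p : DoubleCover a) (m n : ℤ), Odd (m + n) → p.pt = latticePt δ a m n →
      s p.root = 0 → α m n.natAbs = 0)
    (hβ : ∀ (p : DoubleCover a) (m n : ℤ), Even (m + n) → p.pt = latticePt δ a m n →
      t p.root = 0 → β m n.natAbs = 0) :
    IsSHolomorphic δ a (spinorExt δ a α β s t) := by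
  have hsign : ∀ p q : DoubleCover a, 0 < (q.root / p.root).re → (q.pt - a).im ≠ 0 →
      0 ≤ (p.pt - a).im * (q.pt - a).im →
      (s p.root = 0 ∨ s q.root = s p.root) ∧ (t p.root = 0 ∨ t q.root = t p.root) := by
    intro p q h hq hpq
    have := DoubleCover.sign_root_eq h hq hpq
    rcases hst with ⟨rfl, rfl⟩ | ⟨rfl, rfl⟩
    · exact this
    · exact this.symm
  have hup : ∀ p : DoubleCover a, 0 < (p.pt - a).im → s p.root = t p.root := by
    intro p h
    have := DoubleCover.sign_re_eq_sign_im h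
    rcases hst with ⟨rfl, rfl⟩ | ⟨rfl, rfl⟩
    · exact this
    · exact this.symm
  have hdown : ∀ p : DoubleCover a, (p.pt - a).im < 0 → s p.root = -t p.root := by
    intro p h
    have := DoubleCover.sign_re_eq_neg_sign_im h
    rcases hst with ⟨rfl, rfl⟩ | ⟨rfl, rfl⟩
    · exact this
    · simp only [this, neg_neg]
  -- At corners of type `1` and `i`: the adjacent medial vertices are in the same half-plane.
  have hlattice : ∀ (p q : DoubleCover a) (m n m' n' : ℤ), p.pt = latticePt δ a m n →
      q.pt = medialPt δ a m' n' → p.Adjacent δ q → m' = m ∧ (n' = n ∨ n' = n - 1) ∧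
      (s p.root = 0 ∨ s q.root = s p.root) ∧ (t p.root = 0 ∨ t q.root = t p.root) := by
    intro p q m n m' n' hp hq hadj
    obtain ⟨hm, hn⟩ := eq_of_dist_latticePt_medialPt hδ (hp ▸ hq ▸ hadj.1)
    refine ⟨hm, hn, hsign p q hadj.2 ?_ ?_⟩
    · rw [hq, im_medialPt_sub]
      exact mul_ne_zero hδ.ne' (int_add_half_ne_zero _)
    · rw [hp, hq, im_medialPt_sub, im_latticePt_sub]
      have : 0 ≤ (n : ℝ) * (n' + 1 / 2) := by
        rcases hn with rfl | rfl
        · rcases le_or_gt 0 n' with h | h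
          · exact mul_nonneg (by exact_mod_cast h) (int_add_half_pos_iff.2 h).le
          · refine mul_nonneg_of_nonpos_of_nonpos (by exact_mod_cast h.le) ?_
            exact not_lt.1 fun h' => absurd (int_add_half_pos_iff.1 h') (by omega)
        · rcases le_or_gt n 0 with h | h
          · refine mul_nonneg_of_nonpos_of_nonpos (by exact_mod_cast h) ?_
            exact not_lt.1 fun h' => absurd (int_add_half_pos_iff.1 h') (by omega)
          · exact mul_nonneg (by exact_mod_cast h.le) (int_add_half_pos_iff.2 (by omega)).le
      calc (0 : ℝ) ≤ δ ^ 2 * (n * (n' + 1 / 2)) := by positivity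
        _ = _ := by ring
  -- At the other corners all the signs agree.
  have hcross : ∀ (p q : DoubleCover a) (m n m' n' : ℤ), p.pt = crossPt δ a m n →
      q.pt = medialPt δ a m' n' → p.Adjacent δ q → n' = n ∧ (m' = m ∨ m' = m - 1) ∧
      s q.root = s p.root ∧ t q.root = t p.root ∧
      (0 ≤ n ∧ s p.root = t p.root ∨ n < 0 ∧ s p.root = -t p.root) := by
    intro p q m n m' n' hp hq hadj
    obtain ⟨rfl, hm⟩ := eq_of_dist_crossPt_medialPt hδ (hp ▸ hq ▸ hadj.1)
    have hp' := im_crossPt_sub δ a m n'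
    have hq' := im_medialPt_sub δ a m' n'
    rw [← hp] at hp'
    rw [← hq] at hq'
    have hne := mul_ne_zero hδ.ne' (int_add_half_ne_zero n')
    have hs := hsign p q hadj.2 (by rwa [hq']) (by rw [hp', hq']; exact mul_self_nonneg _)
    have : t p.root ≠ 0 := by
      have h0 := DoubleCover.im_pt_sub p
      rw [hp'] at h0
      have hr : p.root.re ≠ 0 ∧ p.root.im ≠ 0 :=
        ⟨fun h => hne (by rw [h0, h]; ring), fun h => hne (by rw [h0, h]; ring)⟩
      rcases hst with ⟨rfl, rfl⟩ | ⟨rfl, rfl⟩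
      · simpa using hr.2
      · simpa using hr.1
    refine ⟨rfl, hm, ?_⟩
    rcases le_or_gt 0 n' with hn | hn
    · have hpos := mul_pos hδ (int_add_half_pos_iff.2 hn)
      have e1 := hup p (by rwa [hp'])
      have e2 := hup q (by rwa [hq'])
      rw [e1, e2] at hs ⊢
      exact ⟨hs.2.resolve_left this, hs.2.resolve_left this, Or.inl ⟨hn, rfl⟩⟩
    · have hneg : δ * (n' + 1 / 2 : ℝ) < 0 := by
        refine lt_of_le_of_ne (mul_nonpos_of_nonneg_of_nonpos hδ.le ?_) hne
        exact not_lt.1 fun h' => absurd (int_add_half_pos_iff.1 h') (by omega)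
      have e1 := hdown p (by rwa [hp'])
      have e2 := hdown q (by rwa [hq'])
      rw [e1, e2] at hs ⊢
      have h3 := hs.2.resolve_left this
      exact ⟨by rw [h3], h3, Or.inr ⟨hn, rfl⟩⟩
  -- The Cauchy–Riemann equations with signs, in both half-planes.
  have hCR : ∀ (m n : ℤ) (x y : ℝ), (0 ≤ n ∧ x = y ∨ n < 0 ∧ x = -y) →
      (x * α m n.natAbs - y * β m (n + 1).natAbs
        = x * α (m - 1) (n + 1).natAbs - y * β (m - 1) n.natAbs) ∧
      (x * α m (n + 1).natAbs + y * β m n.natAbs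
        = x * α (m - 1) n.natAbs + y * β (m - 1) (n + 1).natAbs) := by
    rintro m n x y (⟨hn, rfl⟩ | ⟨hn, rfl⟩)
    · lift n to ℕ using hn
      have e : ((n : ℤ) + 1).natAbs = n + 1 := by omega
      have c1 := h1 (m - 1) n
      have c2 := h2 (m - 1) n
      rw [sub_add_cancel] at c1 c2
      rw [e, Int.natAbs_natCast]
      exact ⟨by linear_combination x * c1, by linear_combination x * c2⟩
    · obtain ⟨k, rfl⟩ : ∃ k : ℕ, n = -(k + 1) := ⟨(-n - 1).toNat, by omega⟩
      have e1 : (-((k : ℤ) + 1)).natAbs = k + 1 := by omega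
      have e2 : (-((k : ℤ) + 1) + 1).natAbs = k := by omega
      have c1 := h1 (m - 1) k
      have c2 := h2 (m - 1) k
      rw [sub_add_cancel] at c1 c2
      rw [e1, e2]
      exact ⟨by linear_combination -y * c2, by linear_combination -y * c1⟩
  intro τ p q hp hq hadj
  obtain ⟨m', n', hq⟩ := exists_medialPt_of_mem hδ hq
  have hδ' : (starRingEnd ℂ) (δ : ℂ) = δ := conj_ofReal δ
  cases τ with
  | one =>
    obtain ⟨m, n, hodd, hp⟩ := exists_latticePt_of_mem_one hp
    obtain ⟨rfl, hn, hs, -⟩ := hlattice p q m n m' n' hp hq hadj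
    have hv : s q.root * α m' n.natAbs = s p.root * α m' n.natAbs := by
      rcases hs with h | h
      · rw [hα p m' n hodd hp h, mul_zero, mul_zero]
      · rw [h]
    rw [spinorExt_of_latticePt hδ hp, spinorExt_of_medialPt hδ hq, cornerVal, if_pos hodd, ← hv,
      map_mul, hδ', CornerType.val]
    rcases hn with rfl | rfl
    · rw [medialVal_of_odd hodd, conj_add_mul_I]
      ring
    · rw [medialVal_of_even (by grind), conj_add_mul_I, sub_add_cancel]
      ring
  | i =>
    obtain ⟨m, n, heven, hp⟩ := exists_latticePt_of_mem_i hp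
    obtain ⟨rfl, hn, -, ht⟩ := hlattice p q m n m' n' hp hq hadj
    have hv : t q.root * β m' n.natAbs = t p.root * β m' n.natAbs := by
      rcases ht with h | h
      · rw [hβ p m' n heven hp h, mul_zero, mul_zero]
      · rw [h]
    rw [spinorExt_of_latticePt hδ hp, spinorExt_of_medialPt hδ hq, cornerVal,
      if_neg (Int.not_odd_iff_even.2 heven), ← hv, map_mul, hδ', CornerType.val, I_sq]
    rcases hn with rfl | rfl
    · rw [medialVal_of_even heven, conj_add_mul_I]
      ring
    · rw [medialVal_of_odd (by grind), conj_add_mul_I, sub_add_cancel]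
      ring
  | lam =>
    obtain ⟨m, n, hodd, hp⟩ := exists_crossPt_of_mem_lam hp
    obtain ⟨rfl, hm, hs, ht, hn⟩ := hcross p q m n m' n' hp hq hadj
    rw [spinorExt_of_crossPt hδ hp, spinorExt_of_medialPt hδ hq, hs, ht, val_lam_sq, map_mul, hδ',
      crossVal, if_pos hodd]
    rcases hm with rfl | rfl
    · ring
    · have h := congrArg (fun x : ℝ => (x : ℂ)) (hCR m n' _ _ hn).1
      rw [medialVal_of_odd hodd, medialVal_of_even (by grind), conj_add_mul_I, conj_add_mul_I]
      push_cast at h ⊢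
      linear_combination (δ / 2 * (1 - I) : ℂ) * h
        + (δ / 2 * (t p.root * (β m (n' + 1).natAbs - β (m - 1) n'.natAbs)) : ℂ) * I_sq
  | lamBar =>
    obtain ⟨m, n, heven, hp⟩ := exists_crossPt_of_mem_lamBar hp
    obtain ⟨rfl, hm, hs, ht, hn⟩ := hcross p q m n m' n' hp hq hadj
    rw [spinorExt_of_crossPt hδ hp, spinorExt_of_medialPt hδ hq, hs, ht, val_lamBar_sq, map_mul,
      hδ', crossVal, if_neg (Int.not_odd_iff_even.2 heven)]
    rcases hm with rfl | rfl
    · ring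
    · have h := congrArg (fun x : ℝ => (x : ℂ)) (hCR m n' _ _ hn).2
      rw [medialVal_of_even heven, medialVal_of_odd (by grind), conj_add_mul_I, conj_add_mul_I]
      push_cast at h ⊢
      linear_combination (δ / 2 * (1 + I) : ℂ) * h
        - (δ / 2 * (t p.root * (β m n'.natAbs - β (m - 1) (n' + 1).natAbs)) : ℂ) * I_sq

end spinorExt

/-! ### The two spinors -/

/-- The spinor `G`. -/
def slitG (δ : ℝ) (a : ℂ) : DoubleCover a → ℂ :=
  spinorExt δ a discreteSqrt (fun m n => discreteSqrt (-1 - m) n)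
    (fun r => Real.sign r.re) (fun r => Real.sign r.im)

/-- The spinor `G̃`: in the upper half-plane it is `i` times the translate of `G` by `δ`. -/
def slitGTilde (δ : ℝ) (a : ℂ) : DoubleCover a → ℂ :=
  spinorExt δ a (fun m n => -discreteSqrt (-m) n) (fun m n => discreteSqrt (m - 1) n)
    (fun r => Real.sign r.im) (fun r => Real.sign r.re)

lemma isSpinor_slitG (δ : ℝ) (a : ℂ) : IsSpinor δ a (slitG δ a) :=
  isSpinor_spinorExt (fun r => by rw [neg_re, Real.sign_neg])
    (fun r => by rw [neg_im, Real.sign_neg])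

lemma isSpinor_slitGTilde (δ : ℝ) (a : ℂ) : IsSpinor δ a (slitGTilde δ a) :=
  isSpinor_spinorExt (fun r => by rw [neg_im, Real.sign_neg])
    (fun r => by rw [neg_re, Real.sign_neg])

lemma isSHolomorphic_slitG {δ : ℝ} (hδ : 0 < δ) (a : ℂ) : IsSHolomorphic δ a (slitG δ a) := by
  refine isSHolomorphic_spinorExt hδ (Or.inl ⟨rfl, rfl⟩) (fun m n => ?_) (fun m n => ?_)
    (fun p m n hmn hp h => ?_) (fun p m n hmn hp h => ?_)
  · rw [(discreteSqrt_cauchyRiemann m n).1, show -1 - (m + 1) = -2 - m by ring]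
  · rw [(discreteSqrt_cauchyRiemann m n).2, show -1 - (m + 1) = -2 - m by ring]
  · obtain ⟨rfl, hm⟩ := DoubleCover.slit_of_sign_re hδ hp h
    exact discreteSqrt_of_neg (by simpa using hmn) hm
  · obtain ⟨rfl, hm⟩ := DoubleCover.slit_of_sign_im hδ hp h
    exact discreteSqrt_of_neg (by grind) (by omega)

lemma isSHolomorphic_slitGTilde {δ : ℝ} (hδ : 0 < δ) (a : ℂ) :
    IsSHolomorphic δ a (slitGTilde δ a) := by
  refine isSHolomorphic_spinorExt hδ (Or.inr ⟨rfl, rfl⟩) (fun m n => ?_) (fun m n => ?_)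
    (fun p m n hmn hp h => ?_) (fun p m n hmn hp h => ?_)
  · have := (discreteSqrt_cauchyRiemann (m - 1) n).2
    rw [show -1 - (m - 1) = -m by ring, show -2 - (m - 1) = -(m + 1) by ring] at this
    rw [add_sub_cancel_right]
    rw [sub_add_cancel] at this
    linarith
  · have := (discreteSqrt_cauchyRiemann (m - 1) n).1
    rw [show -1 - (m - 1) = -m by ring, show -2 - (m - 1) = -(m + 1) by ring] at this
    rw [add_sub_cancel_right]
    rw [sub_add_cancel] at this
    linarith
  · obtain ⟨rfl, hm⟩ := DoubleCover.slit_of_sign_im hδ hp h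
    have h0 : m ≠ 0 := by rintro rfl; simp at hmn
    rw [Int.natAbs_zero, discreteSqrt_of_neg (by grind) (by omega), neg_zero]
  · obtain ⟨rfl, hm⟩ := DoubleCover.slit_of_sign_re hδ hp h
    exact discreteSqrt_of_neg (by grind) (by omega)

lemma hasSum_HX {δ : ℝ} (hδ : 0 < δ) (a : ℂ) {m n : ℤ} (h : Odd (m + n)) :
    HasSum (fun j : ℕ => HX δ a (latticePt δ a m n - 2 * j * δ)) (discreteSqrt m n.natAbs : ℂ) := by
  have hj : ∀ j : ℕ, Odd (m - 2 * j + n) := fun j => by grind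
  refine (hasSum_ofReal.2 (hasSum_tipMeasure h fun j => tipMeasure_nonneg (hj j))).congr_fun ?_
  intro j
  rw [← HX_latticePt hδ a (hj j)]
  congr 1
  simp only [latticePt]
  push_cast
  ring

lemma hasSum_HY {δ : ℝ} (hδ : 0 < δ) (a : ℂ) {m n : ℤ} (h : Even (m + n)) :
    HasSum (fun j : ℕ => HY δ a (latticePt δ a m n + 2 * j * δ))
      (-I * discreteSqrt (1 - m) n.natAbs : ℂ) := by
  have hj : ∀ j : ℕ, Odd (1 - m - 2 * j + n) := fun j => by grind
  refine ((hasSum_ofReal.2 (hasSum_tipMeasure (m := 1 - m) (by grind)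
    fun j => tipMeasure_nonneg (hj j))).mul_left (-I)).congr_fun ?_
  intro j
  rw [show 1 - m - 2 * (j : ℤ) = 1 - (m + 2 * j) by ring,
    ← HY_latticePt hδ a (m := m + 2 * j) (by grind)]
  congr 1
  simp only [latticePt]
  push_cast
  ring

lemma isSlitSumG_slitG {δ : ℝ} (hδ : 0 < δ) (a : ℂ) : IsSlitSumG δ a (slitG δ a) := by
  constructor
  · intro p hp
    obtain ⟨m, n, hmn, hp⟩ := exists_latticePt_of_mem_one hp
    have h := ((hasSum_HX hδ a hmn).mul_left (Real.sign p.root.re : ℂ)).mul_left (δ : ℂ)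
    rw [slitG, spinorExt_of_latticePt hδ hp, cornerVal, if_pos hmn, hp]
    push_cast
    exact h
  · intro p hp
    obtain ⟨m, n, hmn, hp⟩ := exists_latticePt_of_mem_i hp
    have h := ((hasSum_HY hδ a (m := m + 2) (n := n) (by grind)).mul_left
      (Real.sign p.root.im : ℂ)).mul_left (-δ : ℂ)
    rw [slitG, spinorExt_of_latticePt hδ hp, cornerVal, if_neg (Int.not_odd_iff_even.2 hmn), hp]
    have e : (δ : ℂ) * (((Real.sign p.root.im * discreteSqrt (-1 - m) n.natAbs : ℝ) : ℂ) * I)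
        = -δ * (Real.sign p.root.im * (-I * discreteSqrt (1 - (m + 2)) n.natAbs)) := by
      rw [show 1 - (m + 2) = -1 - m by ring]
      push_cast
      ring
    rw [e]
    refine h.congr_fun fun j => ?_
    congr 3
    simp only [latticePt]
    push_cast
    ring

lemma isSlitSumGTilde_slitGTilde {δ : ℝ} (hδ : 0 < δ) (a : ℂ) :
    IsSlitSumGTilde δ a (slitGTilde δ a) := by
  constructor
  · intro p hp
    obtain ⟨m, n, hmn, hp⟩ := exists_latticePt_of_mem_one hp
    have h := ((hasSum_HY hδ a (m := m + 1) (n := n) (by grind)).mul_left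
      (Real.sign p.root.im : ℂ)).mul_left (-I * δ : ℂ)
    rw [slitGTilde, spinorExt_of_latticePt hδ hp, cornerVal, if_pos hmn, hp]
    have e : (δ : ℂ) * ((Real.sign p.root.im * -discreteSqrt (-m) n.natAbs : ℝ) : ℂ)
        = -I * δ * (Real.sign p.root.im * (-I * discreteSqrt (1 - (m + 1)) n.natAbs)) := by
      rw [show 1 - (m + 1) = -m by ring]
      push_cast
      linear_combination (-(δ * Real.sign p.root.im * discreteSqrt (-m) n.natAbs) : ℂ) * I_sq
    rw [e]
    refine h.congr_fun fun j => ?_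
    congr 3
    simp only [latticePt]
    push_cast
    ring
  · intro p hp
    obtain ⟨m, n, hmn, hp⟩ := exists_latticePt_of_mem_i hp
    have h := ((hasSum_HX hδ a (m := m - 1) (n := n) (by grind)).mul_left
      (Real.sign p.root.re : ℂ)).mul_left (I * δ : ℂ)
    rw [slitGTilde, spinorExt_of_latticePt hδ hp, cornerVal,
      if_neg (Int.not_odd_iff_even.2 hmn), hp]
    have e : (δ : ℂ) * (((Real.sign p.root.re * discreteSqrt (m - 1) n.natAbs : ℝ) : ℂ) * I)
        = I * δ * (Real.sign p.root.re * discreteSqrt (m - 1) n.natAbs) := by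
      push_cast
      ring
    rw [e]
    refine h.congr_fun fun j => ?_
    congr 3
    simp only [latticePt]
    push_cast
    ring

/-! ### The scaling limit of the integral -/

/-- The integrand of the scaling limit. -/
def limitKernel (x y s : ℝ) : ℝ :=
  s ^ (-(3 / 2) : ℝ) * (Real.sin (x * s - Real.pi / 4) * Real.exp (-y * s) + Real.sin (Real.pi / 4))

/-- The scaling limit `∫₀^∞ s^(-3/2) (sin(xs - π/4) exp(-ys) + sin(π/4)) ds` of `sqrtIntegral`. -/
def limitIntegral (x y : ℝ) : ℝ := ∫ s in Ioi (0 : ℝ), limitKernel x y s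

/-- The dominating function for the scaling limit. -/
def dominant (M s : ℝ) : ℝ :=
  if s ≤ 1 then M * s ^ (-(1 / 2) : ℝ) else 2 * s ^ (-(3 / 2) : ℝ)

lemma integrableOn_dominant (M : ℝ) : IntegrableOn (dominant M) (Ioi 0) := by
  rw [← Ioc_union_Ioi_eq_Ioi zero_le_one]
  refine IntegrableOn.union ?_ ?_
  · have h := (intervalIntegral.intervalIntegrable_rpow' (a := 0) (b := 1)
      (show (-1 : ℝ) < -(1 / 2) by norm_num)).const_mul M
    rw [intervalIntegrable_iff_integrableOn_Ioc_of_le zero_le_one] at h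
    exact h.congr_fun (fun s hs => by rw [dominant, if_pos hs.2]) measurableSet_Ioc
  · have h := (integrableOn_Ioi_rpow_of_lt (show (-(3 / 2) : ℝ) < -1 by norm_num)
      one_pos).const_mul 2
    exact IntegrableOn.congr_fun h (fun s hs => by rw [dominant, if_neg (not_le.2 hs)])
      measurableSet_Ioi

lemma rpow_mul_le_dominant {M s b : ℝ} (hs : 0 < s) (h1 : b ≤ 2) (h2 : b ≤ M * s) :
    s ^ (-(3 / 2) : ℝ) * b ≤ dominant M s := by
  have hp : 0 ≤ s ^ (-(3 / 2) : ℝ) := Real.rpow_nonneg hs.le _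
  rw [dominant]
  split_ifs with h
  · have h3 : s ^ (-(1 / 2) : ℝ) = s ^ (-(3 / 2) : ℝ) * s := by
      rw [← Real.rpow_add_one hs.ne']; norm_num
    rw [h3]
    calc _ ≤ s ^ (-(3 / 2) : ℝ) * (M * s) := mul_le_mul_of_nonneg_left h2 hp
      _ = _ := by ring
  · rw [mul_comm]
    exact mul_le_mul_of_nonneg_right h1 hp

lemma hasDerivAt_log_decay : HasDerivAt (fun t => Real.log (decay t)) (-1) 0 := by
  have h1 : HasDerivAt decay (-1) 0 := by
    have h := (Real.hasDerivAt_cos 0).div ((Real.hasDerivAt_sin 0).const_add 1) (by simp)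
    simp only [Real.sin_zero, Real.cos_zero] at h
    exact h.congr_deriv (by norm_num)
  have h0 : decay 0 = 1 := by simp [decay]
  have h := h1.log (by rw [h0]; exact one_ne_zero)
  rwa [h0, div_one] at h

section ScalingLimit

variable {δ x : ℕ → ℝ} {n : ℕ → ℕ} {X Y : ℝ}

lemma tendsto_decay_pow (hδ : ∀ k, 0 < δ k) (hδ0 : Tendsto δ atTop (𝓝 0))
    (hn : Tendsto (fun k => δ k * n k) atTop (𝓝 Y)) {s : ℝ} (hs : 0 < s) :
    Tendsto (fun k => decay (δ k * s) ^ n k) atTop (𝓝 (Real.exp (-Y * s))) := by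
  have h0 : Tendsto (fun k => δ k * s) atTop (𝓝 0) := by simpa using hδ0.mul_const s
  have h1 : Tendsto (fun k => (δ k * s)⁻¹ * Real.log (decay (δ k * s))) atTop (𝓝 (-1)) := by
    have h := (hasDerivAt_iff_tendsto_slope_zero.1 hasDerivAt_log_decay).comp
      (tendsto_nhdsWithin_iff.2 ⟨h0, Eventually.of_forall fun k => (mul_pos (hδ k) hs).ne'⟩)
    refine h.congr fun k => ?_
    simp [decay]
  have h2 := ((hn.mul_const s).mul h1).rexp
  rw [show Y * s * -1 = -Y * s by ring] at h2
  refine h2.congr' ?_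
  filter_upwards [h0.eventually (gt_mem_nhds (show (0 : ℝ) < Real.pi / 2 by positivity))] with k hk
  have hp := mul_pos (hδ k) hs
  have hd := decay_pos ⟨hp.le, hk⟩
  rw [show δ k * n k * s * ((δ k * s)⁻¹ * Real.log (decay (δ k * s)))
    = (δ k * s * (δ k * s)⁻¹) * (n k * Real.log (decay (δ k * s))) by ring,
    mul_inv_cancel₀ hp.ne', one_mul, Real.exp_nat_mul, Real.exp_log hd]

lemma sqrt_mul_mul_sin_rpow {d t : ℝ} (hd : 0 < d) (ht : 0 < Real.sin t) :
    √d * (d * Real.sin t ^ (-(3 / 2) : ℝ)) = (Real.sin t / d) ^ (-(3 / 2) : ℝ) := by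
  rw [Real.div_rpow ht.le hd.le, Real.rpow_neg hd.le, div_inv_eq_mul, Real.sqrt_eq_rpow,
    show (3 / 2 : ℝ) = 1 / 2 + 1 by norm_num, Real.rpow_add_one hd.ne']
  ring

lemma tendsto_sin_div (hδ : ∀ k, 0 < δ k) (hδ0 : Tendsto δ atTop (𝓝 0)) {s : ℝ} (hs : 0 < s) :
    Tendsto (fun k => Real.sin (δ k * s) / δ k) atTop (𝓝 s) := by
  have h0 : Tendsto (fun k => δ k * s) atTop (𝓝 0) := by simpa using hδ0.mul_const s
  have h := (hasDerivAt_iff_tendsto_slope_zero.1 (Real.hasDerivAt_sin 0)).comp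
    (tendsto_nhdsWithin_iff.2 ⟨h0, Eventually.of_forall fun k => (mul_pos (hδ k) hs).ne'⟩)
  have h2 := h.const_mul s
  rw [Real.cos_zero, mul_one] at h2
  refine h2.congr fun k => ?_
  have := (hδ k).ne'
  simp only [Function.comp, zero_add, Real.sin_zero, sub_zero, smul_eq_mul]
  field_simp

lemma sqrt_mul_sqrtIntegral {d : ℝ} (hd : 0 < d) (x : ℝ) (n : ℕ) :
    √d * sqrtIntegral x n = ∫ s in Ioi (0 : ℝ),
      √d * (d * (Ioc 0 (Real.pi / 2)).indicator (sqrtKernel x n) (d * s)) := by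
  rw [integral_const_mul, integral_const_mul]
  have h := integral_comp_mul_left_Ioi' ((Ioc 0 (Real.pi / 2)).indicator (sqrtKernel x n)) 0 hd
  rw [mul_zero, smul_eq_mul] at h
  rw [h, setIntegral_indicator measurableSet_Ioc, inter_eq_right.2 Ioc_subset_Ioi_self,
    sqrtIntegral, intervalIntegral.integral_of_le (by positivity)]

/-- After rescaling `t = δ s` the integral converges by dominated convergence. -/
lemma tendsto_sqrt_mul_sqrtIntegral (hδ : ∀ k, 0 < δ k) (hδ0 : Tendsto δ atTop (𝓝 0))
    (hx : Tendsto (fun k => δ k * x k) atTop (𝓝 X))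
    (hn : Tendsto (fun k => δ k * n k) atTop (𝓝 Y)) :
    Tendsto (fun k => √(δ k) * sqrtIntegral (x k) (n k)) atTop (𝓝 (limitIntegral X Y)) := by
  simp only [fun k => sqrt_mul_sqrtIntegral (hδ k) (x k) (n k), limitIntegral]
  have hM : ∀ᶠ k in atTop, |δ k * x k| + δ k * n k + δ k < |X| + Y + 1 := by
    have h := (hx.abs.add hn).add hδ0
    exact h.eventually (gt_mem_nhds (by linarith))
  refine tendsto_integral_filter_of_dominated_convergence
    (fun s => (2 / Real.pi) ^ (-(3 / 2) : ℝ) * dominant (|X| + Y + 1) s) ?_ ?_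
    ((integrableOn_dominant _).const_mul _) ?_
  · refine Eventually.of_forall fun k => Measurable.aestronglyMeasurable ?_
    exact ((((measurable_sqrtKernel _ _).indicator measurableSet_Ioc).comp
      (measurable_const_mul _)).const_mul _).const_mul _
  · filter_upwards [hM] with k hk
    refine (ae_restrict_iff' measurableSet_Ioi).2 (Eventually.of_forall fun s hs => ?_)
    have hs0 : (0 : ℝ) < s := hs
    have hdom : ∀ b : ℝ, b ≤ 2 → b ≤ (|X| + Y + 1) * s →
        (2 / Real.pi) ^ (-(3 / 2) : ℝ) * s ^ (-(3 / 2) : ℝ) * b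
          ≤ (2 / Real.pi) ^ (-(3 / 2) : ℝ) * dominant (|X| + Y + 1) s := fun b h1 h2 => by
      rw [mul_assoc]
      exact mul_le_mul_of_nonneg_left (rpow_mul_le_dominant hs0 h1 h2) (by positivity)
    by_cases ht : δ k * s ∈ Ioc 0 (Real.pi / 2)
    · rw [indicator_of_mem ht, sqrtKernel, ← mul_assoc, ← mul_assoc, mul_assoc √(δ k),
        sqrt_mul_mul_sin_rpow (hδ k) (sin_pos_of_mem ht), norm_mul, Real.norm_eq_abs,
        Real.norm_eq_abs,
        abs_of_nonneg (Real.rpow_nonneg (div_pos (sin_pos_of_mem ht) (hδ k)).le _)]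
      have hb : (Real.sin (δ k * s) / δ k) ^ (-(3 / 2) : ℝ)
          ≤ (2 / Real.pi) ^ (-(3 / 2) : ℝ) * s ^ (-(3 / 2) : ℝ) := by
        rw [← Real.mul_rpow (by positivity) hs0.le]
        refine Real.rpow_le_rpow_of_nonpos (by positivity) ?_ (by norm_num)
        rw [le_div_iff₀ (hδ k)]
        calc 2 / Real.pi * s * δ k = 2 / Real.pi * (δ k * s) := by ring
          _ ≤ _ := Real.mul_le_sin ht.1.le ht.2
      refine (mul_le_mul_of_nonneg_right hb (abs_nonneg _)).trans (hdom _
        (abs_bracket_le_two (Ioc_subset_Icc_self ht) _ _)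
        ((abs_bracket_le_mul (Ioc_subset_Icc_self ht) _ _).trans ?_))
      rw [abs_mul, abs_of_pos (hδ k)] at hk
      calc (|x k| + n k + 1) * (δ k * s) = (δ k * |x k| + δ k * n k + δ k) * s := by ring
        _ ≤ _ := mul_le_mul_of_nonneg_right hk.le hs0.le
    · rw [indicator_of_notMem ht, mul_zero, mul_zero, norm_zero]
      have hMpos : 0 ≤ (|X| + Y + 1) * s := by
        have := abs_nonneg (δ k * x k)
        have := mul_nonneg (hδ k).le (Nat.cast_nonneg (α := ℝ) (n k))
        have := hδ k
        exact mul_nonneg (by linarith) hs0.le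
      simpa using hdom 0 zero_le_two hMpos
  · refine (ae_restrict_iff' measurableSet_Ioi).2 (Eventually.of_forall fun s hs => ?_)
    have hs0 : (0 : ℝ) < s := hs
    have h0 : Tendsto (fun k => δ k * s) atTop (𝓝 0) := by simpa using hδ0.mul_const s
    have h1 := (tendsto_sin_div hδ hδ0 hs0).rpow_const (p := -(3 / 2)) (Or.inl hs0.ne')
    have h2 : Tendsto (fun k => bracket (x k) (n k) (δ k * s)) atTop
        (𝓝 (Real.sin (X * s - Real.pi / 4) * Real.exp (-Y * s) + Real.sin (Real.pi / 4))) := by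
      refine Tendsto.add (Tendsto.mul ?_ (tendsto_decay_pow hδ hδ0 hn hs0)) ?_
      · refine (Real.continuous_sin.tendsto _).comp (Tendsto.sub_const ?_ _)
        refine (hx.mul_const s).congr fun k => by ring
      · refine (Real.continuous_sin.tendsto _).comp ?_
        simpa using (h0.div_const 2).add_const (Real.pi / 4)
    refine (h1.mul h2).congr' ?_
    filter_upwards [h0.eventually (gt_mem_nhds (show (0 : ℝ) < Real.pi / 2 by positivity))]
      with k hk
    have ht : δ k * s ∈ Ioc 0 (Real.pi / 2) := ⟨mul_pos (hδ k) hs0, hk.le⟩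
    rw [indicator_of_mem ht, sqrtKernel, ← sqrt_mul_mul_sin_rpow (hδ k) (sin_pos_of_mem ht)]
    ring

end ScalingLimit

lemma measurable_limitKernel (x y : ℝ) : Measurable (limitKernel x y) := by
  unfold limitKernel
  exact (measurable_id.pow_const _).mul (by fun_prop)

lemma abs_limitKernel_le {x y M s : ℝ} (hy : 0 ≤ y) (hM : |x| + y ≤ M) (hs : 0 < s) :
    |limitKernel x y s| ≤ dominant M s := by
  have he0 := (Real.exp_pos (-y * s)).le
  have he1 : Real.exp (-y * s) ≤ 1 := Real.exp_le_one_iff.2 (by nlinarith)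
  have he2 : 1 - Real.exp (-y * s) ≤ y * s := by linarith [Real.add_one_le_exp (-y * s)]
  have h1 := Real.abs_sin_le_one (x * s - Real.pi / 4)
  have h2 := Real.abs_sin_le_one (Real.pi / 4)
  rw [limitKernel, abs_mul, abs_of_nonneg (Real.rpow_nonneg hs.le _)]
  refine rpow_mul_le_dominant hs ?_ ?_
  · calc _ ≤ |Real.sin (x * s - Real.pi / 4)| * |Real.exp (-y * s)| + |Real.sin (Real.pi / 4)| := by
          rw [← abs_mul]; exact abs_add_le _ _
      _ ≤ 1 * 1 + 1 := by
          rw [abs_of_nonneg he0]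
          exact add_le_add (mul_le_mul h1 he1 he0 zero_le_one) h2
      _ = 2 := by norm_num
  · have h3 := abs_sin_sub_sin_le (x * s - Real.pi / 4) (-(Real.pi / 4))
    rw [show x * s - Real.pi / 4 - -(Real.pi / 4) = x * s by ring, abs_mul, abs_of_pos hs] at h3
    have key : Real.sin (x * s - Real.pi / 4) * Real.exp (-y * s) + Real.sin (Real.pi / 4)
        = (Real.sin (x * s - Real.pi / 4) - Real.sin (-(Real.pi / 4))) * Real.exp (-y * s)
          + Real.sin (Real.pi / 4) * (1 - Real.exp (-y * s)) := by
      rw [Real.sin_neg]; ring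
    rw [key]
    calc _ ≤ |Real.sin (x * s - Real.pi / 4) - Real.sin (-(Real.pi / 4))| * |Real.exp (-y * s)|
          + |Real.sin (Real.pi / 4)| * |1 - Real.exp (-y * s)| := by
          rw [← abs_mul, ← abs_mul]; exact abs_add_le _ _
      _ ≤ |x| * s * 1 + 1 * (y * s) := by
          rw [abs_of_nonneg he0, abs_of_nonneg (sub_nonneg.2 he1)]
          exact add_le_add (mul_le_mul h3 he1 he0 (by positivity))
            (mul_le_mul h2 he2 (sub_nonneg.2 he1) zero_le_one)
      _ ≤ M * s := by nlinarith

/-- The limit integral is continuous up to the real axis. -/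
lemma tendsto_limitIntegral {x y : ℝ} (hy : 0 ≤ y) :
    Tendsto (fun k : ℕ => limitIntegral x (y + 1 / (k + 1))) atTop (𝓝 (limitIntegral x y)) := by
  have h0 : Tendsto (fun k : ℕ => y + 1 / ((k : ℝ) + 1)) atTop (𝓝 y) := by
    simpa using (tendsto_one_div_add_atTop_nhds_zero_nat (𝕜 := ℝ)).const_add y
  refine tendsto_integral_filter_of_dominated_convergence (dominant (|x| + (y + 1)))
    (Eventually.of_forall fun k => (measurable_limitKernel _ _).aestronglyMeasurable) ?_
    (integrableOn_dominant _) ?_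
  · refine Eventually.of_forall fun k =>
      (ae_restrict_iff' measurableSet_Ioi).2 (Eventually.of_forall fun s hs => ?_)
    have h1 : 1 / ((k : ℝ) + 1) ≤ 1 := by
      rw [div_le_one (by positivity)]; linarith [Nat.cast_nonneg (α := ℝ) k]
    exact abs_limitKernel_le (by positivity) (by linarith) hs
  · refine Eventually.of_forall fun s => ?_
    refine Tendsto.const_mul _ (Tendsto.add_const _ (Tendsto.const_mul _ ?_))
    exact ((h0.neg.mul_const s)).rexp

/-! ### Evaluation of the limit integral -/

section Evaluation

variable {b : ℂ}

lemma norm_one_sub_exp_le_two (hb : 0 ≤ b.re) {s : ℝ} (hs : 0 ≤ s) :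
    ‖1 - exp (-b * s)‖ ≤ 2 := by
  have h : ‖exp (-b * s)‖ ≤ 1 := by
    rw [norm_exp, Real.exp_le_one_iff, re_mul_ofReal, neg_re]
    nlinarith
  calc _ ≤ ‖(1 : ℂ)‖ + ‖exp (-b * s)‖ := norm_sub_le _ _
    _ ≤ 2 := by rw [norm_one]; linarith

lemma norm_one_sub_exp_le_mul (hb : 0 ≤ b.re) {s : ℝ} (hs : 0 ≤ s) :
    ‖1 - exp (-b * s)‖ ≤ 2 * ‖b‖ * s := by
  have hn : ‖-b * (s : ℂ)‖ = ‖b‖ * s := by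
    rw [norm_mul, norm_neg, norm_real, Real.norm_eq_abs, abs_of_nonneg hs]
  rcases le_total ‖-b * (s : ℂ)‖ 1 with h | h
  · have := norm_exp_sub_one_le h
    rw [norm_sub_rev, mul_assoc, ← hn]
    exact this
  · refine (norm_one_sub_exp_le_two hb hs).trans ?_
    rw [hn] at h
    linarith

lemma integrableOn_rpow_smul_exp (hb : 0 < b.re) :
    IntegrableOn (fun s : ℝ => s ^ (-(1 / 2) : ℝ) • exp (-b * s)) (Ioi 0) := by
  have h := integrableOn_rpow_mul_exp_neg_mul_rpow (s := -(1 / 2)) (p := 1) (by norm_num)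
    one_pos hb
  refine Integrable.mono' h (Measurable.aestronglyMeasurable
    ((measurable_id.pow_const _).smul (by fun_prop)))
    ((ae_restrict_iff' measurableSet_Ioi).2 (Eventually.of_forall fun s hs => ?_))
  rw [norm_smul, Real.norm_eq_abs, abs_of_nonneg (Real.rpow_nonneg (le_of_lt hs) _), norm_exp,
    re_mul_ofReal, neg_re, Real.rpow_one]

lemma integrableOn_rpow_smul_one_sub_exp (hb : 0 ≤ b.re) :
    IntegrableOn (fun s : ℝ => s ^ (-(3 / 2) : ℝ) • (1 - exp (-b * s))) (Ioi 0) := by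
  refine Integrable.mono' (integrableOn_dominant (2 * ‖b‖)) (Measurable.aestronglyMeasurable
    ((measurable_id.pow_const _).smul (by fun_prop)))
    ((ae_restrict_iff' measurableSet_Ioi).2 (Eventually.of_forall fun s hs => ?_))
  have hs0 : (0 : ℝ) < s := hs
  rw [norm_smul, Real.norm_eq_abs, abs_of_nonneg (Real.rpow_nonneg hs0.le _)]
  exact rpow_mul_le_dominant hs0 (norm_one_sub_exp_le_two hb hs0.le)
    (norm_one_sub_exp_le_mul hb hs0.le)

/-- The substitution `s = t²` in the Gaussian integral. -/
lemma integral_rpow_smul_exp (hb : 0 < b.re) :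
    ∫ s in Ioi (0 : ℝ), s ^ (-(1 / 2) : ℝ) • exp (-b * s) = (Real.pi / b) ^ (1 / 2 : ℂ) := by
  have h := integral_comp_rpow_Ioi_of_pos (g := fun t : ℝ => exp (-b * (t : ℂ) ^ 2))
    (p := 1 / 2) (by norm_num)
  rw [integral_gaussian_complex_Ioi hb] at h
  have h2 : ∫ s in Ioi (0 : ℝ), (1 / 2 * s ^ ((1 / 2 : ℝ) - 1)) •
      exp (-b * ((s ^ (1 / 2 : ℝ) : ℝ) : ℂ) ^ 2)
      = ∫ s in Ioi (0 : ℝ), (1 / 2 : ℝ) • (s ^ (-(1 / 2) : ℝ) • exp (-b * s)) := by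
    refine setIntegral_congr_fun measurableSet_Ioi fun s hs => ?_
    have hs0 : (0 : ℝ) < s := hs
    simp only [smul_smul]
    rw [← ofReal_pow, ← Real.rpow_natCast, ← Real.rpow_mul hs0.le]
    norm_num
  rw [h2, integral_smul, real_smul] at h
  push_cast at h
  linear_combination 2 * h

/-- Integration by parts. -/
lemma integral_rpow_smul_one_sub_exp (hb : 0 < b.re) :
    ∫ s in Ioi (0 : ℝ), s ^ (-(3 / 2) : ℝ) • (1 - exp (-b * s))
      = 2 * b * (Real.pi / b) ^ (1 / 2 : ℂ) := by
  have hi1 := integrableOn_rpow_smul_one_sub_exp hb.le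
  have hi2 := (integrableOn_rpow_smul_exp hb).const_mul (2 * b)
  have hbound : ∀ s : ℝ, 0 < s → ‖(-2 * s ^ (-(1 / 2) : ℝ)) • (1 - exp (-b * s))‖
      = 2 * (s ^ (-(1 / 2) : ℝ) * ‖1 - exp (-b * s)‖) := fun s hs => by
    rw [norm_smul, norm_mul, Real.norm_eq_abs, Real.norm_eq_abs,
      abs_of_nonneg (Real.rpow_nonneg hs.le _)]
    norm_num [mul_assoc]
  have key := integral_Ioi_of_hasDerivAt_of_tendsto (a := 0) (m := 0)
    (f := fun s : ℝ => (-2 * s ^ (-(1 / 2) : ℝ)) • (1 - exp (-b * s)))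
    (f' := fun s : ℝ => s ^ (-(3 / 2) : ℝ) • (1 - exp (-b * s))
      - 2 * b * (s ^ (-(1 / 2) : ℝ) • exp (-b * s))) ?_ ?_ (hi1.sub hi2) ?_
  · rw [integral_sub hi1 hi2, integral_const_mul, integral_rpow_smul_exp hb] at key
    have h0 : (0 : ℝ) ^ (-(1 / 2) : ℝ) = 0 := Real.zero_rpow (by norm_num)
    rw [h0, mul_zero, zero_smul, sub_zero] at key
    exact sub_eq_zero.1 key
  · -- At `0` the function is `O(s^(1/2))`; the power `0 ^ (-1/2)` is `0`.
    have h0 : (0 : ℝ) ^ (-(1 / 2) : ℝ) = 0 := Real.zero_rpow (by norm_num)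
    have h1 : Tendsto (fun s : ℝ => 4 * ‖b‖ * s ^ (1 / 2 : ℝ)) (𝓝[≥] 0) (𝓝 0) := by
      have h := ((Real.continuous_rpow_const (q := 1 / 2) (by norm_num)).tendsto 0).const_mul
        (4 * ‖b‖)
      rw [Real.zero_rpow (by norm_num), mul_zero] at h
      exact h.mono_left nhdsWithin_le_nhds
    unfold ContinuousWithinAt
    beta_reduce
    rw [h0, mul_zero, zero_smul]
    refine squeeze_zero_norm' ?_ h1
    filter_upwards [self_mem_nhdsWithin] with s hs
    rcases (show (0 : ℝ) ≤ s from hs).eq_or_lt with rfl | hs0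
    · rw [h0, mul_zero, zero_smul, norm_zero]
      positivity
    · have h2 : s ^ (1 / 2 : ℝ) = s ^ (-(1 / 2) : ℝ) * s := by
        rw [← Real.rpow_add_one hs0.ne']; norm_num
      have h3 := norm_one_sub_exp_le_mul hb.le hs0.le
      have := mul_le_mul_of_nonneg_left h3 (Real.rpow_nonneg hs0.le (-(1 / 2)))
      rw [hbound s hs0, h2]
      linarith
  · intro s hs
    have hs0 : (0 : ℝ) < s := hs
    have d1 : HasDerivAt (fun s : ℝ => s ^ (-(1 / 2) : ℝ)) (-(1 / 2) * s ^ (-(1 / 2) - 1 : ℝ)) s :=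
      Real.hasDerivAt_rpow_const (Or.inl hs0.ne')
    have d2 : HasDerivAt (fun s : ℝ => 1 - exp (-b * s)) (-(exp (-b * s) * (-b * 1))) s :=
      ((((hasDerivAt_id s).ofReal_comp).const_mul (-b)).cexp).const_sub 1
    refine ((d1.const_mul (-2)).smul d2).congr_deriv ?_
    rw [show (-(1 / 2) - 1 : ℝ) = -(3 / 2) by norm_num]
    simp only [real_smul]
    push_cast
    ring
  · have h1 : Tendsto (fun s : ℝ => 2 * (s ^ (-(1 / 2) : ℝ) * 2)) atTop (𝓝 0) := by
      have := ((tendsto_rpow_neg_atTop (show (0 : ℝ) < 1 / 2 by norm_num)).mul_const 2).const_mul 2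
      simpa using this
    refine squeeze_zero_norm' ?_ h1
    filter_upwards [eventually_gt_atTop 0] with s hs
    rw [hbound s hs]
    have := norm_one_sub_exp_le_two hb.le hs.le
    have := Real.rpow_nonneg hs.le (-(1 / 2))
    gcongr

lemma re_cpow_half_nonneg (z : ℂ) : 0 ≤ (z ^ (1 / 2 : ℂ)).re := by
  rcases eq_or_ne z 0 with rfl | hz
  · simp
  rw [cpow_def_of_ne_zero hz, exp_re]
  refine mul_nonneg (Real.exp_pos _).le (Real.cos_nonneg_of_mem_Icc ?_)
  have h : (log z * (1 / 2)).im = arg z / 2 := by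
    rw [show (1 / 2 : ℂ) = ((1 / 2 : ℝ) : ℂ) by push_cast; rfl, im_mul_ofReal, log_im]
    ring
  rw [h]
  exact ⟨by linarith [neg_pi_lt_arg z], by linarith [arg_le_pi z]⟩

lemma limitKernel_eq_im (x y s : ℝ) : limitKernel x y s
    = (-exp (-(Real.pi / 4) * I) * (s ^ (-(3 / 2) : ℝ) • (1 - exp (-(y - x * I) * s)))).im := by
  have e1 : exp (-(Real.pi / 4) * I) * exp (-(y - x * I) * s)
      = (Real.exp (-y * s) : ℂ) * exp ((x * s - Real.pi / 4 : ℝ) * I) := by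
    rw [ofReal_exp, ← Complex.exp_add, ← Complex.exp_add]
    congr 1
    push_cast
    ring
  have e2 : exp (-(Real.pi / 4) * I) = exp ((-(Real.pi / 4) : ℝ) * I) := by push_cast; rfl
  have e3 : -exp (-(Real.pi / 4) * I) * (s ^ (-(3 / 2) : ℝ) • (1 - exp (-(y - x * I) * s)))
      = ((s ^ (-(3 / 2) : ℝ) : ℝ) : ℂ) * ((Real.exp (-y * s) : ℂ)
        * exp ((x * s - Real.pi / 4 : ℝ) * I) - exp ((-(Real.pi / 4) : ℝ) * I)) := by
    rw [← e1, ← e2, real_smul]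
    ring
  rw [e3, im_ofReal_mul, sub_im, im_ofReal_mul, exp_ofReal_mul_I_im, exp_ofReal_mul_I_im,
    Real.sin_neg, limitKernel]
  ring

/-- The real part of `√(x + iy)` in the closed upper half-plane, as a function of real variables. -/
def sqrtRe (x y : ℝ) : ℝ := √((√(x ^ 2 + y ^ 2) + x) / 2)

/-- In the open upper half-plane, `limitIntegral x y` is the imaginary part of a square root of
`-4π(x + iy)`; it is the root with positive imaginary part. -/
lemma limitIntegral_of_pos (x : ℝ) {y : ℝ} (hy : 0 < y) :
    limitIntegral x y = 2 * √Real.pi * sqrtRe x y := by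
  set b : ℂ := y - x * I with hb
  have hre : b.re = y := by simp [hb]
  have him : b.im = -x := by simp [hb]
  have hbpos : 0 < b.re := hre ▸ hy
  have hb0 : b ≠ 0 := by rintro h; rw [h, zero_re] at hbpos; exact lt_irrefl _ hbpos
  have hpi : (Real.pi : ℂ) ≠ 0 := ofReal_ne_zero.2 Real.pi_ne_zero
  set ρ : ℂ := (Real.pi / b) ^ (1 / 2 : ℂ) with hρ
  have hρ2 : ρ ^ 2 = Real.pi / b := by
    rw [hρ, ← cpow_nat_mul]; norm_num
  have hρ0 : ρ ≠ 0 := by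
    intro h
    rw [h, zero_pow two_ne_zero] at hρ2
    exact div_ne_zero hpi hb0 hρ2.symm
  set σ : ℂ := b * ρ with hσ
  have hσρ : σ = Real.pi / ρ := by
    rw [hσ, eq_div_iff hρ0, mul_assoc, ← sq, hρ2]
    field_simp
  have hσ2 : σ ^ 2 = Real.pi * b := by
    rw [hσ, mul_pow, hρ2]
    field_simp
  have hσre : 0 ≤ σ.re := by
    rw [hσρ, div_re, ofReal_im, ofReal_re, zero_mul, zero_div, add_zero]
    have := re_cpow_half_nonneg (Real.pi / b)
    have := Real.pi_pos
    have := normSq_nonneg ρ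
    positivity
  have hr := congrArg re hσ2
  have hi := congrArg im hσ2
  rw [sq, mul_re, re_ofReal_mul, hre] at hr
  rw [sq, mul_im, im_ofReal_mul, him] at hi
  have hlim : limitIntegral x y = √2 * (σ.re - σ.im) := by
    have hint := (integrableOn_rpow_smul_one_sub_exp hbpos.le).const_mul
      (-exp (-(Real.pi / 4) * I))
    have h := integral_im hint
    simp only [RCLike.im_eq_complex_im] at h
    rw [integral_const_mul, integral_rpow_smul_one_sub_exp hbpos] at h
    have h2 : exp (-(Real.pi / 4) * I) = ((√2 / 2 : ℝ) : ℂ) * (1 - I) := by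
      rw [show (-(Real.pi / 4) * I : ℂ) = ((-(Real.pi / 4) : ℝ) : ℂ) * I by push_cast; rfl,
        exp_mul_I, ← ofReal_cos, ← ofReal_sin, Real.cos_neg, Real.sin_neg, Real.cos_pi_div_four,
        Real.sin_pi_div_four]
      push_cast
      ring
    rw [limitIntegral, setIntegral_congr_fun measurableSet_Ioi
      fun s _ => limitKernel_eq_im x y s, h, ← hρ, h2,
      show -(((√2 / 2 : ℝ) : ℂ) * (1 - I)) * (2 * b * ρ) = ((√2 : ℝ) : ℂ) * ((I - 1) * σ) by
        rw [hσ]; push_cast; ring, im_ofReal_mul, mul_im]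
    simp
    ring
  have hsum : √(x ^ 2 + y ^ 2) = (σ.re ^ 2 + σ.im ^ 2) / Real.pi := by
    rw [eq_div_iff Real.pi_ne_zero, ← Real.sqrt_sq (by positivity : 0 ≤ σ.re ^ 2 + σ.im ^ 2),
      ← Real.sqrt_sq Real.pi_pos.le, ← Real.sqrt_mul (by positivity)]
    congr 1
    have : (σ.re ^ 2 + σ.im ^ 2) ^ 2
        = (σ.re * σ.re - σ.im * σ.im) ^ 2 + (σ.re * σ.im + σ.im * σ.re) ^ 2 := by ring
    rw [this, hr, hi]
    ring
  have hdiff : 0 ≤ σ.re - σ.im := by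
    have : 0 < Real.pi * y := mul_pos Real.pi_pos hy
    nlinarith
  have hsq : (√2 * (σ.re - σ.im)) ^ 2 = 4 * Real.pi * ((√(x ^ 2 + y ^ 2) + x) / 2) := by
    rw [hsum, mul_pow, Real.sq_sqrt zero_le_two]
    field_simp
    linear_combination -4 * hi
  have hnn : 0 ≤ √2 * (σ.re - σ.im) := mul_nonneg (Real.sqrt_nonneg _) hdiff
  rw [hlim, ← Real.sqrt_sq hnn, hsq, Real.sqrt_mul (by positivity), sqrtRe,
    Real.sqrt_mul (by norm_num), show (4 : ℝ) = 2 ^ 2 by norm_num, Real.sqrt_sq zero_le_two]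

lemma continuous_sqrtRe (x : ℝ) : Continuous (sqrtRe x) := by
  unfold sqrtRe
  fun_prop

lemma limitIntegral_eq (x : ℝ) {y : ℝ} (hy : 0 ≤ y) :
    limitIntegral x y = 2 * √Real.pi * sqrtRe x y := by
  have h0 : Tendsto (fun k : ℕ => y + 1 / ((k : ℝ) + 1)) atTop (𝓝 y) := by
    simpa using (tendsto_one_div_add_atTop_nhds_zero_nat (𝕜 := ℝ)).const_add y
  refine tendsto_nhds_unique (tendsto_limitIntegral hy) ?_
  refine ((((continuous_sqrtRe x).tendsto y).comp h0).const_mul (2 * √Real.pi)).congr fun k => ?_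
  exact (limitIntegral_of_pos x (by positivity)).symm

end Evaluation

/-! ### Convergence on compact subsets -/

/-- The constant in `discreteSqrt m n ~ scalingConst * Re √(m + in)`. -/
def scalingConst : ℝ := 2 * √Real.pi / sqrtIntegral (3 / 2) 0

lemma scalingConst_pos : 0 < scalingConst :=
  div_pos (mul_pos two_pos (Real.sqrt_pos.2 Real.pi_pos)) sqrtIntegral_tip_pos

lemma tendsto_discreteSqrt {δ : ℕ → ℝ} {m n : ℕ → ℤ} {x y : ℝ} (hδ : ∀ k, 0 < δ k)
    (hδ0 : Tendsto δ atTop (𝓝 0)) (hm : Tendsto (fun k => δ k * m k) atTop (𝓝 x))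
    (hn : Tendsto (fun k => δ k * n k) atTop (𝓝 y)) :
    Tendsto (fun k => √(δ k) * discreteSqrt (m k) (n k).natAbs) atTop
      (𝓝 (scalingConst * sqrtRe x y)) := by
  have hn' : Tendsto (fun k => δ k * ((n k).natAbs : ℝ)) atTop (𝓝 |y|) := by
    refine hn.abs.congr fun k => ?_
    rw [abs_mul, abs_of_pos (hδ k), Nat.cast_natAbs, Int.cast_abs]
  have hm' : Tendsto (fun k => δ k * (m k + 1 / 2 : ℝ)) atTop (𝓝 x) := by
    have := hm.add (hδ0.mul_const (1 / 2))
    rw [zero_mul, add_zero] at this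
    exact this.congr fun k => by ring
  have h := (tendsto_sqrt_mul_sqrtIntegral hδ hδ0 hm' hn').div_const (sqrtIntegral (3 / 2) 0)
  rw [limitIntegral_eq _ (abs_nonneg y)] at h
  have e : 2 * √Real.pi * sqrtRe x |y| / sqrtIntegral (3 / 2) 0 = scalingConst * sqrtRe x y := by
    rw [scalingConst, sqrtRe, sqrtRe, sq_abs]
    ring
  rw [e] at h
  refine h.congr fun k => ?_
  rw [discreteSqrt]
  ring

/-- The value of `ϑ(δ)`: on the positive half-axis the harmonic measure is `discreteSqrt` divided by
the distance to the tip. -/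
lemma vartheta_eq {δ : ℝ} (hδ : 0 < δ) (a : ℂ) :
    vartheta δ a = ((discreteSqrt (2 * ⌊1 / (2 * δ)⌋ + 1) 0 / (2 * ⌊1 / (2 * δ)⌋ + 1) : ℝ) : ℂ) := by
  have hk : 0 ≤ ⌊1 / (2 * δ)⌋ := Int.floor_nonneg.2 (by positivity)
  obtain ⟨k, hk⟩ := Int.eq_ofNat_of_zero_le hk
  have hpt : a + 3 * δ / 2 + 2 * δ * ((⌊1 / (2 * δ)⌋ : ℤ) : ℂ)
      = latticePt δ a (2 * ⌊1 / (2 * δ)⌋ + 1) 0 := by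
    simp only [latticePt]; push_cast; ring
  rw [vartheta, hpt, HX_latticePt hδ a (by grind), hk, tipMeasure_eq, discreteSqrt]
  congr 1
  have h := sqrtIntegral_of_nonneg k
  push_cast
  rw [show (2 * (k : ℝ) + 1 + 1 / 2) = 2 * k + 3 / 2 by ring, h,
    show (2 * (k : ℝ) + 1 + -(1 / 2)) = 2 * k + 1 / 2 by ring]
  have : (2 * (k : ℝ) + 1) ≠ 0 := by positivity
  have := sqrtIntegral_tip_pos.ne'
  field_simp

lemma tendsto_vartheta {δ : ℕ → ℝ} (hδ : ∀ k, 0 < δ k) (hδ0 : Tendsto δ atTop (𝓝 0)) (a : ℂ) :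
    Tendsto (fun k => vartheta (δ k) a / (√(δ k) : ℝ)) atTop (𝓝 (scalingConst : ℂ)) := by
  have h1 : Tendsto (fun k => δ k * (2 * (⌊1 / (2 * δ k)⌋ : ℝ) + 1)) atTop (𝓝 1) := by
    refine tendsto_of_tendsto_of_tendsto_of_le_of_le (g := fun k => 1 - δ k)
      (h := fun k => 1 + δ k) (by simpa using hδ0.const_sub 1) (by simpa using hδ0.const_add 1) ?_ ?_
    · intro k
      have h := Int.lt_floor_add_one (1 / (2 * δ k))
      rw [div_lt_iff₀ (by linarith [hδ k])] at h
      simp only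
      linarith
    · intro k
      have h := Int.floor_le (1 / (2 * δ k))
      rw [le_div_iff₀ (by linarith [hδ k])] at h
      simp only
      linarith
  have h2 := tendsto_discreteSqrt (m := fun k => 2 * ⌊1 / (2 * δ k)⌋ + 1) (n := fun _ => 0)
    hδ hδ0 (x := 1) (y := 0) (by exact_mod_cast h1) (by simp)
  have h3 := h2.div h1 one_ne_zero
  have e : scalingConst * sqrtRe 1 0 / 1 = scalingConst := by simp [sqrtRe]
  rw [e] at h3
  refine ((continuous_ofReal.tendsto _).comp h3).congr fun k => ?_
  rw [vartheta_eq (hδ k)]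
  simp only [Function.comp, Pi.div_apply, Int.natAbs_zero]
  rw [← ofReal_div]
  congr 1
  have hs : δ k = √(δ k) * √(δ k) := (Real.mul_self_sqrt (hδ k).le).symm
  have hs0 : √(δ k) ≠ 0 := (Real.sqrt_pos.2 (hδ k)).ne'
  conv_lhs => rw [show δ k * (2 * (⌊1 / (2 * δ k)⌋ : ℝ) + 1)
    = √(δ k) * √(δ k) * (2 * (⌊1 / (2 * δ k)⌋ : ℝ) + 1) by rw [← hs]]
  field_simp

lemma tendsto_sign_mul {u v : ℕ → ℝ} {u₀ c : ℝ} (hu : Tendsto u atTop (𝓝 u₀))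
    (hv : Tendsto v atTop (𝓝 (c * |u₀|))) :
    Tendsto (fun k => Real.sign (u k) * v k) atTop (𝓝 (c * u₀)) := by
  rcases lt_trichotomy u₀ 0 with h | rfl | h
  · rw [abs_of_neg h] at hv
    have := hv.const_mul (-1)
    rw [show -1 * (c * -u₀) = c * u₀ by ring] at this
    refine this.congr' ?_
    filter_upwards [hu.eventually (gt_mem_nhds h)] with k hk
    rw [Real.sign_of_neg hk]
  · rw [abs_zero, mul_zero] at hv
    rw [mul_zero]
    refine squeeze_zero_norm (fun k => ?_) (by simpa using hv.norm)
    rw [norm_mul]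
    refine mul_le_of_le_one_left (norm_nonneg _) ?_
    rcases Real.sign_apply_eq (u k) with h | h | h <;> rw [h] <;> norm_num
  · rw [abs_of_pos h] at hv
    refine hv.congr' ?_
    filter_upwards [hu.eventually (lt_mem_nhds h)] with k hk
    rw [Real.sign_of_pos hk, one_mul]

lemma sqrtRe_pt {a : ℂ} (p : DoubleCover a) :
    sqrtRe (p.pt - a).re (p.pt - a).im = |p.root.re| ∧
    sqrtRe (-(p.pt - a).re) (p.pt - a).im = |p.root.im| := by
  have h : √((p.pt - a).re ^ 2 + (p.pt - a).im ^ 2) = p.root.re ^ 2 + p.root.im ^ 2 := by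
    rw [← Real.sqrt_sq (by positivity : 0 ≤ p.root.re ^ 2 + p.root.im ^ 2),
      DoubleCover.re_pt_sub, DoubleCover.im_pt_sub]
    congr 1
    ring
  constructor
  · rw [sqrtRe, h, DoubleCover.re_pt_sub, ← Real.sqrt_sq_eq_abs]
    congr 1
    ring
  · rw [sqrtRe, neg_sq, h, DoubleCover.re_pt_sub, ← Real.sqrt_sq_eq_abs]
    congr 1
    ring

/-- Convergence of a spinor obtained by extension from the half-plane, given the scaling limits of
its real and imaginary parts up to sign. By compactness of the set it suffices to consider sequences
`δₖ → 0`, `pₖ → p`; where a sign is discontinuous the corresponding part of the limit vanishes. -/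
lemma convergesOnCompacts_spinorExt {a : ℂ} {α β : ℤ → ℕ → ℝ} {u v : ℂ → ℝ} {d e : ℝ}
    (hu : Continuous u) (hv : Continuous v)
    (hα : ∀ (δ : ℕ → ℝ) (m n : ℕ → ℤ) (p : DoubleCover a), (∀ k, 0 < δ k) →
      Tendsto δ atTop (𝓝 0) → Tendsto (fun k => δ k * m k) atTop (𝓝 (p.pt - a).re) →
      Tendsto (fun k => δ k * n k) atTop (𝓝 (p.pt - a).im) →
      Tendsto (fun k => √(δ k) * α (m k) (n k).natAbs) atTop (𝓝 (scalingConst * d * |u p.root|)))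
    (hβ : ∀ (δ : ℕ → ℝ) (m n : ℕ → ℤ) (p : DoubleCover a), (∀ k, 0 < δ k) →
      Tendsto δ atTop (𝓝 0) → Tendsto (fun k => δ k * m k) atTop (𝓝 (p.pt - a).re) →
      Tendsto (fun k => δ k * n k) atTop (𝓝 (p.pt - a).im) →
      Tendsto (fun k => √(δ k) * β (m k) (n k).natAbs) atTop (𝓝 (scalingConst * e * |v p.root|))) :
    ConvergesOnCompacts a
      (fun δ p => (vartheta δ a)⁻¹ * spinorExt δ a α β
        (fun r => Real.sign (u r)) (fun r => Real.sign (v r)) p)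
      (fun p => ((d * u p.root : ℝ) : ℂ) + ((e * v p.root : ℝ) : ℂ) * I) := by
  intro K hK ε hε
  by_contra! hcon
  have hcon' : ∀ k : ℕ, ∃ δ : ℝ, 0 < δ ∧ δ < 1 / ((k : ℝ) + 1) ∧ ∃ p ∈ K, p.pt ∈ medialSet δ a ∧
      ε ≤ ‖(vartheta δ a)⁻¹ * spinorExt δ a α β
        (fun r => Real.sign (u r)) (fun r => Real.sign (v r)) p
        - (((d * u p.root : ℝ) : ℂ) + ((e * v p.root : ℝ) : ℂ) * I)‖ := fun k => by
    obtain ⟨δ, h1, h2, p, h3, h4, h5⟩ := hcon (1 / ((k : ℝ) + 1)) (by positivity)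
    exact ⟨δ, h1, h2, p, h3, h4, h5⟩
  choose δ' hδ' hδlt P' hPK hPm hPε using hcon'
  obtain ⟨p, -, φ, hφ, hlim⟩ := hK.tendsto_subseq hPK
  set δ := δ' ∘ φ with hδdef
  set P := P' ∘ φ with hPdef
  have hδ : ∀ k, 0 < δ k := fun k => hδ' (φ k)
  have hδ0 : Tendsto δ atTop (𝓝 0) :=
    (squeeze_zero (fun k => (hδ' k).le) (fun k => (hδlt k).le)
      tendsto_one_div_add_atTop_nhds_zero_nat).comp hφ.tendsto_atTop
  have hmed : ∀ k, ∃ m n : ℤ, (P k).pt = medialPt (δ k) a m n :=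
    fun k => exists_medialPt_of_mem (hδ k) (hPm (φ k))
  choose m n hP using hmed
  have hpt : Tendsto (fun k => (P k).pt - a) atTop (𝓝 (p.pt - a)) :=
    (((continuous_fst.comp continuous_subtype_val).tendsto p).comp hlim).sub_const a
  have hroot : Tendsto (fun k => (P k).root) atTop (𝓝 p.root) :=
    ((continuous_snd.comp continuous_subtype_val).tendsto p).comp hlim
  have hm : Tendsto (fun k => δ k * m k) atTop (𝓝 (p.pt - a).re) := by
    have h := ((continuous_re.tendsto _).comp hpt).sub (hδ0.mul_const (1 / 2))
    rw [zero_mul, sub_zero] at h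
    refine h.congr fun k => ?_
    simp only [Function.comp, hP, medialPt]
    simp
    ring
  have hn : Tendsto (fun k => δ k * n k) atTop (𝓝 (p.pt - a).im) := by
    have h := ((continuous_im.tendsto _).comp hpt).sub (hδ0.mul_const (1 / 2))
    rw [zero_mul, sub_zero] at h
    refine h.congr fun k => ?_
    simp only [Function.comp, hP, im_medialPt_sub]
    ring
  -- The rows of the adjacent corners of types `1` and `i`.
  set n₁ : ℕ → ℤ := fun k => if Odd (m k + n k) then n k else n k + 1 with hn₁
  set n₂ : ℕ → ℤ := fun k => if Odd (m k + n k) then n k + 1 else n k with hn₂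
  have hnear : ∀ N : ℕ → ℤ, (∀ k, N k = n k ∨ N k = n k + 1) →
      Tendsto (fun k => δ k * N k) atTop (𝓝 (p.pt - a).im) := by
    intro N hN
    refine tendsto_of_tendsto_of_tendsto_of_le_of_le hn
      (by simpa using hn.add hδ0 : Tendsto (fun k => δ k * n k + δ k) atTop _) ?_ ?_ <;> intro k <;>
    · have := hδ k
      rcases hN k with h | h <;> simp only [h] <;> push_cast <;> linarith
  have hval : ∀ k, medialVal α β (Real.sign (u (P k).root)) (Real.sign (v (P k).root)) (m k) (n k)
      = ((Real.sign (u (P k).root) * α (m k) (n₁ k).natAbs : ℝ) : ℂ)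
        + ((Real.sign (v (P k).root) * β (m k) (n₂ k).natAbs : ℝ) : ℂ) * I := by
    intro k
    by_cases h : Odd (m k + n k)
    · rw [medialVal_of_odd h]
      simp only [hn₁, hn₂, if_pos h]
    · rw [medialVal_of_even (Int.not_odd_iff_even.1 h)]
      simp only [hn₁, hn₂, if_neg h]
  have hA := tendsto_sign_mul ((hu.tendsto _).comp hroot) (hα δ m n₁ p hδ hδ0 hm
    (hnear n₁ fun k => by simp only [hn₁]; split_ifs <;> simp))
  have hB := tendsto_sign_mul ((hv.tendsto _).comp hroot) (hβ δ m n₂ p hδ hδ0 hm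
    (hnear n₂ fun k => by simp only [hn₂]; split_ifs <;> simp))
  have hc0 : (scalingConst : ℂ) ≠ 0 := ofReal_ne_zero.2 scalingConst_pos.ne'
  have hθ := (tendsto_vartheta hδ hδ0 a).inv₀ hc0
  have hF := hθ.mul (((continuous_ofReal.tendsto _).comp hA).add
    (((continuous_ofReal.tendsto _).comp hB).mul_const I))
  have hG : Tendsto (fun k => ((d * u (P k).root : ℝ) : ℂ) + ((e * v (P k).root : ℝ) : ℂ) * I)
      atTop (𝓝 (((d * u p.root : ℝ) : ℂ) + ((e * v p.root : ℝ) : ℂ) * I)) :=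
    ((continuous_ofReal.tendsto _).comp (((hu.tendsto _).comp hroot).const_mul d)).add
      (((continuous_ofReal.tendsto _).comp (((hv.tendsto _).comp hroot).const_mul e)).mul_const I)
  have hdiff := (hF.sub hG).norm
  have e0 : (scalingConst : ℂ)⁻¹ * (((scalingConst * d * u p.root : ℝ) : ℂ)
      + ((scalingConst * e * v p.root : ℝ) : ℂ) * I)
      - (((d * u p.root : ℝ) : ℂ) + ((e * v p.root : ℝ) : ℂ) * I) = 0 := by
    push_cast
    field_simp
    ring
  rw [e0, norm_zero] at hdiff
  refine absurd (ge_of_tendsto' hdiff fun k => ?_) (not_le.2 hε)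
  refine (hPε (φ k)).trans (le_of_eq ?_)
  change ‖(vartheta (δ k) a)⁻¹ * spinorExt (δ k) a α β _ _ (P k)
    - (((d * u (P k).root : ℝ) : ℂ) + ((e * v (P k).root : ℝ) : ℂ) * I)‖ = _
  rw [spinorExt_of_medialPt (hδ k) (hP k), hval]
  congr 2
  have hs : (δ k : ℂ) = ((√(δ k) : ℝ) : ℂ) * ((√(δ k) : ℝ) : ℂ) := by
    rw [← ofReal_mul, Real.mul_self_sqrt (hδ k).le]
  simp only [Function.comp]
  rw [inv_div]
  push_cast
  rw [hs]
  ring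

lemma convergesOnCompacts_slitG (a : ℂ) :
    ConvergesOnCompacts a (fun δ p => (vartheta δ a)⁻¹ * slitG δ a p) (fun p => p.root) := by
  have h := convergesOnCompacts_spinorExt (a := a) (α := discreteSqrt)
    (β := fun m n => discreteSqrt (-1 - m) n) (u := re) (v := im) (d := 1) (e := 1)
    continuous_re continuous_im
    (fun δ m n p hδ hδ0 hm hn => by
      rw [mul_one, ← (sqrtRe_pt p).1]
      exact tendsto_discreteSqrt hδ hδ0 hm hn)
    (fun δ m n p hδ hδ0 hm hn => by
      rw [mul_one, ← (sqrtRe_pt p).2]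
      refine tendsto_discreteSqrt hδ hδ0 ?_ hn
      have := (hm.add hδ0).neg
      rw [add_zero] at this
      refine this.congr fun k => ?_
      push_cast
      ring)
  simp only [one_mul, re_add_im] at h
  exact h

lemma convergesOnCompacts_slitGTilde (a : ℂ) :
    ConvergesOnCompacts a (fun δ p => (vartheta δ a)⁻¹ * slitGTilde δ a p)
      (fun p => I * p.root) := by
  have h := convergesOnCompacts_spinorExt (a := a) (α := fun m n => -discreteSqrt (-m) n)
    (β := fun m n => discreteSqrt (m - 1) n) (u := im) (v := re) (d := -1) (e := 1)
    continuous_im continuous_re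
    (fun δ m n p hδ hδ0 hm hn => by
      rw [mul_neg_one, neg_mul, ← (sqrtRe_pt p).2]
      simp only [mul_neg]
      refine (tendsto_discreteSqrt hδ hδ0 ?_ hn).neg
      refine hm.neg.congr fun k => ?_
      push_cast
      ring)
    (fun δ m n p hδ hδ0 hm hn => by
      rw [mul_one, ← (sqrtRe_pt p).1]
      refine tendsto_discreteSqrt hδ hδ0 ?_ hn
      have := hm.sub hδ0
      rw [sub_zero] at this
      refine this.congr fun k => ?_
      push_cast
      ring)
  have e : ∀ p : DoubleCover a, ((-1 * p.root.im : ℝ) : ℂ) + ((1 * p.root.re : ℝ) : ℂ) * I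
      = I * p.root := fun p => by
    apply Complex.ext <;> simp
  simp only [e] at h
  exact h

end

theorem theorem2p14 (a : ℂ) :
    ∃ G Gt : ℝ → DoubleCover a → ℂ,
      (∀ δ : ℝ, 0 < δ →
        IsSpinor δ a (G δ) ∧ IsSHolomorphic δ a (G δ) ∧ IsSlitSumG δ a (G δ) ∧
        IsSpinor δ a (Gt δ) ∧ IsSHolomorphic δ a (Gt δ) ∧ IsSlitSumGTilde δ a (Gt δ)) ∧
      ConvergesOnCompacts a (fun δ p => (vartheta δ a)⁻¹ * G δ p) (fun p => p.root) ∧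
      ConvergesOnCompacts a (fun δ p => (vartheta δ a)⁻¹ * Gt δ p) (fun p => I * p.root) :=
  ⟨fun δ => slitG δ a, fun δ => slitGTilde δ a,
    fun δ hδ => ⟨isSpinor_slitG δ a, isSHolomorphic_slitG hδ a, isSlitSumG_slitG hδ a,
      isSpinor_slitGTilde δ a, isSHolomorphic_slitGTilde hδ a, isSlitSumGTilde_slitGTilde hδ a⟩,
    convergesOnCompacts_slitG a, convergesOnCompacts_slitGTilde a⟩
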